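/- **Setting.** A finite limit theory $\mathbb T$ is given through its syntactic category $\mathcal C_{\mathbb T}$, a small category with finite limits; for a category $\mathcal E$, $\mathbb T[\mathcal E]$ is the category of finite-limit-preserving functors $\mathcal C_{\mathbb T}\to\mathcal E$ and natural transformations. Write $\mathcal B=\mathbb T[\mathrm{Set}]$, and $K_x=\mathcal C_{\mathbb T}(x,-)\in\mathcal B$, so that $x\mapsto K_x$ identifies $\mathcal C_{\mathbb T}^{op}$ with the finitely presentable objects of $\mathcal B$. A *saturated class* in $\mathcal B$ is a class $\mathcal V$ of maps between finitely presentable objects that is closed under composition, contains all isomorphisms between such objects, is right-cancellative ($l\in\mathcal V$, $fl\in\mathcal V$ imply $f\in\mathcal V$), is closed under pushout along maps to finitely presentable objects, and is closed under finite colimits in the category of arrows of $\mathcal B$. A *geometry* is a triple $(\mathbb T,\mathcal V,J)$ with $\mathcal V$ a saturated class in $\mathcal B$ and $J$ a Grothendieck topology on $\mathcal C_{\mathbb T}$ whose covers are generated by duals of maps in $\mathcal V$ (every $J$-covering sieve contains a $J$-covering family of arrows $y\to x$ whose dual $K_x\to K_y$ is in $\mathcal V$). For a Grothendieck topos $\mathcal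 E$, $\mathbb T_J[\mathcal E]\subseteq\mathbb T[\mathcal E]$ is the full subcategory of $J$-continuous models, i.e. those $M$ with $\coprod_i M(x_i)\to M(x)$ epimorphic for every $J$-covering family $(x_i\to x)_i$. For a geometric morphism $g:\mathcal F\to\mathcal E$, $g^*:\mathbb T[\mathcal E]\to\mathbb T[\mathcal F]$ and $g_*:\mathbb T[\mathcal F]\to\mathbb T[\mathcal E]$ are composition with the inverse and direct image. View $\mathcal V$ as a full subcategory of the category of arrows of $\mathcal B$. An arrow $u:M\to N$ of $\mathbb T[\mathcal E]$ is *local*, $u\in\mathrm{Loc}[\mathcal E]$, if its naturality square at each arrow of $\mathcal C_{\mathbb T}$ dual to a map in $\mathcal V$ is a pullback. It is *etale*, $u\in\mathrm{Et}[\mathcal E]$, if it corresponds to some object $P$ of $\mathrm{Lex}[\mathcal V^{op},\mathcal E]\simeq\mathrm{Geom}[\mathcal E,[\mathcal V,\mathrm{Set}]]$, which means: up to isomorphism, $M$ is $x\mapsto P(\mathrm{id}_{K_x})$, $N$ is the left Kan extension of $P$ along the codomain functor $\mathcal V^{op}\to\mathcal C_{\mathbb T}$, and $u$ is the unit of this Kan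 extension at the objects $\mathrm{id}_{K_x}$. Regard $\mathrm{Et}[\mathcal E]$ and $\mathrm{Loc}[\mathcal E]$ as full subcategories of the category of arrows of $\mathbb T[\mathcal E]$. **Statement.** Let $(\mathbb T,\mathcal V,J)$ be a geometry. 1. For every Grothendieck topos $\mathcal E$, $(\mathrm{Et}[\mathcal E],\mathrm{Loc}[\mathcal E])$ is an (orthogonal) factorization system on $\mathbb T[\mathcal E]$. 2. Let $g:\mathcal F\to\mathcal E$ be a geometric morphism of Grothendieck toposes. Then $g^*$ sends $\mathrm{Et}[\mathcal E]$ into $\mathrm{Et}[\mathcal F]$ and $\mathrm{Loc}[\mathcal E]$ into $\mathrm{Loc}[\mathcal F]$. The functor $g^*:\mathrm{Loc}[\mathcal E]\to\mathrm{Loc}[\mathcal F]$ has as right adjoint the restriction of $g_*$. The functor $g^*:\mathrm{Et}[\mathcal E]\to\mathrm{Et}[\mathcal F]$ has a right adjoint, which sends an etale arrow corresponding to $P\in\mathrm{Lex}[\mathcal V^{op},\mathcal F]$ to one corresponding to $g_*\circ P\in\mathrm{Lex}[\mathcal V^{op},\mathcal E]$. 3. For every Grothendieck topos $\mathcal E$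 and $u:F\to E$ in $\mathrm{Loc}[\mathcal E]$ with $E$ in $\mathbb T_J[\mathcal E]$, also $F$ is in $\mathbb T_J[\mathcal E]$. 4. Hence, for every Grothendieck topos $\mathcal E$ and every $f:F\to E$ in $\mathbb T[\mathcal E]$ with $E$ in $\mathbb T_J[\mathcal E]$, if $f=u_fn_f$ with $n_f:F\to H_f$ in $\mathrm{Et}[\mathcal E]$ and $u_f:H_f\to E$ in $\mathrm{Loc}[\mathcal E]$, then $H_f$ is in $\mathbb T_J[\mathcal E]$. 5. So $(\mathbb T,\mathbb T\to\mathbb T_J,\mathrm{Loc})$ is an admissibility structure: the classes $\mathrm{Loc}[\mathcal E]$ are preserved by inverse images along geometric morphisms (so that $\mathrm{Loc}$ is a sub-2-functor of $\mathcal E\mapsto\mathrm{Arrow}(\mathbb T[\mathcal E])$), each contains all isomorphisms and is left-cancellative ($v\in\mathrm{Loc}[\mathcal E]$, $vf\in\mathrm{Loc}[\mathcal E]$ imply $f\in\mathrm{Loc}[\mathcal E]$), and for every $\mathcal E$, every $f:F\to E$ in $\mathbb T[\mathcal E]$ with $E$ in $\mathbb T_J[\mathcal E]$ has a factorization $F\to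 H\xrightarrow{u}E$ with $H$ in $\mathbb T_J[\mathcal E]$ and $u\in\mathrm{Loc}[\mathcal E]$ which is initial among all factorizations of $f$ whose second arrow is in $\mathrm{Loc}[\mathcal E]$. -/

import Mathlib

open CategoryTheory CategoryTheory.Limits

universe u

/-- A Grothendieck topos: a category equivalent to the category of sheaves of (small) sets
on a small site. -/
class IsGrothendieckTopos (E : Type (u + 1)) [Category.{u} E] : Prop where
  exists_site : ∃ (D : Type u) (_ : SmallCategory D) (K : GrothendieckTopology D),
    Nonempty (E ≌ Sheaf K (Type u))

instance IsGrothendieckTopos.hasColimits (E : Type (u + 1)) [Category.{u} E]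
    [IsGrothendieckTopos E] : HasColimits E := by
  obtain ⟨D, _, K, ⟨e⟩⟩ := IsGrothendieckTopos.exists_site (E := E)
  have : HasColimits (Sheaf K (Type u)) := ⟨fun _ _ => by infer_instance⟩
  exact Adjunction.has_colimits_of_equivalence e.functor

/-- A geometric morphism `F ⟶ E`: an adjunction `inverse ⊣ direct` with `inverse : E ⥤ F` and
`direct : F ⥤ E`, where `inverse` preserves finite limits. -/
structure GeometricMorphism (F E : Type (u + 1)) [Category.{u} F] [Category.{u} E] where
  inverse : E ⥤ F
  direct : F ⥤ E
  adj : inverse ⊣ direct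
  lex : PreservesFiniteLimits inverse

/-- An (orthogonal) factorization system `(L, R)` on a category. -/
structure IsFactorizationSystem {B : Type*} [Category* B] (L R : MorphismProperty B) : Prop where
  left_iso : ∀ ⦃X Y : B⦄ (f : X ⟶ Y), IsIso f → L f
  right_iso : ∀ ⦃X Y : B⦄ (f : X ⟶ Y), IsIso f → R f
  left_comp : ∀ ⦃X Y Z : B⦄ (f : X ⟶ Y) (g : Y ⟶ Z), L f → L g → L (f ≫ g)
  right_comp : ∀ ⦃X Y Z : B⦄ (f : X ⟶ Y) (g : Y ⟶ Z), R f → R g → R (f ≫ g)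
  factorization : ∀ ⦃X Y : B⦄ (f : X ⟶ Y),
    ∃ (H : B) (n : X ⟶ H) (v : H ⟶ Y), L n ∧ R v ∧ n ≫ v = f
  orthogonal : ∀ ⦃X Y Z W : B⦄ (l : X ⟶ Y) (r : Z ⟶ W) (a : X ⟶ Z) (b : Y ⟶ W),
    L l → R r → a ≫ r = l ≫ b → ∃! d : Y ⟶ Z, l ≫ d = a ∧ d ≫ r = b

/-- A saturated class of maps of finite presentation (that is, of maps between finitely
presentable objects) in a locally finitely presentable category `B`. -/
structure IsSaturatedClass {B : Type (u + 1)} [Category.{u} B] (V : MorphismProperty B) :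
    Prop where
  source_fp : ∀ ⦃X Y : B⦄ (f : X ⟶ Y), V f → IsFinitelyPresentable.{u} X
  target_fp : ∀ ⦃X Y : B⦄ (f : X ⟶ Y), V f → IsFinitelyPresentable.{u} Y
  comp : ∀ ⦃X Y Z : B⦄ (f : X ⟶ Y) (g : Y ⟶ Z), V f → V g → V (f ≫ g)
  iso : ∀ ⦃X Y : B⦄ (f : X ⟶ Y), IsFinitelyPresentable.{u} X → IsFinitelyPresentable.{u} Y →
    IsIso f → V f
  right_cancel : ∀ ⦃X Y Z : B⦄ (f : X ⟶ Y) (g : Y ⟶ Z), V f → V (f ≫ g) → V g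
  pushout : ∀ ⦃X Y X' Y' : B⦄ (f : X ⟶ Y) (a : X ⟶ X') (a' : Y ⟶ Y') (f' : X' ⟶ Y'),
    V f → IsFinitelyPresentable.{u} X' → IsPushout f a a' f' → V f'
  finite_colimits : ∀ (I : Type) [SmallCategory I] [FinCategory I],
    V.IsStableUnderColimitsOfShape I

section FiniteLimitTheory

/- A finite limit theory `T` is given by its syntactic category: a small category `C` with finite
limits. The category of `T`-models in a category `E` is `C ⥤ₗ E`, the category of finite limit
preserving functors `C ⥤ E` and natural transformations. -/

variable (C : Type u) [SmallCategory C]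

/-- The functor `Cᵒᵖ ⥤ T[Set]`, sending an object (a formula in context) to the model which it
presents, i.e. to its corepresentable functor; it identifies `Cᵒᵖ` with the category of finitely
presentable set-valued models. -/
noncomputable def presentedModel : Cᵒᵖ ⥤ (C ⥤ₗ Type u) :=
  ObjectProperty.lift _ coyoneda (fun X => by
    rw [leftExactFunctor_iff]
    infer_instance)

variable {C} in
lemma isFinitelyPresentable_presentedModel [HasFiniteLimits C] (c : C) :
    IsFinitelyPresentable.{u} ((presentedModel C).obj (Opposite.op c)) := by
  rw [isFinitelyPresentable_iff_preservesFilteredColimits]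
  refine ⟨fun I _ _ => ?_⟩
  have hP : (leftExactFunctor C (Type u)).IsClosedUnderColimitsOfShape I := by
    unfold leftExactFunctor
    infer_instance
  have hι : PreservesColimitsOfShape I (leftExactFunctor C (Type u)).ι := inferInstance
  let e : coyoneda.obj (Opposite.op ((presentedModel C).obj (Opposite.op c))) ≅
      (leftExactFunctor C (Type u)).ι ⋙ (evaluation C (Type u)).obj c :=
    NatIso.ofComponents
      (fun M => (((leftExactFunctor C (Type u)).fullyFaithfulι.homEquiv
        (X := (presentedModel C).obj (Opposite.op c)) (Y := M)).trans coyonedaEquiv).toIso)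
      (fun _ => rfl)
  exact preservesColimitsOfShape_of_natIso e.symm

/-- A geometry on the finite limit theory with syntactic category `C`: a saturated class `V` of
maps in the category of set-valued models, and a Grothendieck topology `J` on `C` whose covers are
generated by duals of maps in `V`: the arrows of a covering sieve which are dual to a map in `V`
already cover. -/
structure Geometry [HasFiniteLimits C] where
  V : MorphismProperty (C ⥤ₗ Type u)
  saturated : IsSaturatedClass V
  J : GrothendieckTopology C
  covers_generated : ∀ ⦃X : C⦄ (S : Sieve X), S ∈ J X →
    Sieve.generate (fun (Y : C) (f : Y ⟶ X) => S f ∧ V ((presentedModel C).map f.op)) ∈ J X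

variable {C}

/-- `F : C ⥤ E` is `J`-continuous: it sends `J`-covering families to epimorphic families. -/
def IsContinuousFor (J : GrothendieckTopology C) {E : Type (u + 1)} [Category.{u} E]
    [IsGrothendieckTopos E] (F : C ⥤ E) : Prop :=
  ∀ (X : C) (I : Type u) (Y : I → C) (s : ∀ i, Y i ⟶ X), Sieve.ofArrows Y s ∈ J X →
    Epi (Sigma.desc (fun i => F.map (s i)) : (∐ fun i => F.obj (Y i)) ⟶ F.obj X)

/-- The models in `E` of the geometric extension `T_J` of `T`: the models of `T` that are
`J`-continuous. -/
def IsExtensionModel (J : GrothendieckTopology C) {E : Type (u + 1)} [Category.{u} E]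
    [IsGrothendieckTopos E] (M : C ⥤ₗ E) : Prop :=
  IsContinuousFor J M.obj

variable (C) in
/-- The inverse image functor `g^* : T[E] ⥤ T[F]` of a geometric morphism `g : F ⟶ E`. -/
def GeometricMorphism.inverseImage {F E : Type (u + 1)} [Category.{u} F] [Category.{u} E]
    (g : GeometricMorphism F E) : (C ⥤ₗ E) ⥤ (C ⥤ₗ F) :=
  (LeftExactFunctor.whiskeringRight C E F).obj ⟨g.inverse, g.lex⟩

variable (C) in
/-- The direct image functor `g_* : T[F] ⥤ T[E]` of a geometric morphism `g : F ⟶ E`. -/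
def GeometricMorphism.directImage {F E : Type (u + 1)} [Category.{u} F] [Category.{u} E]
    (g : GeometricMorphism F E) : (C ⥤ₗ F) ⥤ (C ⥤ₗ E) :=
  (LeftExactFunctor.whiskeringRight C F E).obj
    ⟨g.direct, by
      rw [leftExactFunctor_iff]
      have := g.adj.rightAdjoint_preservesLimits
      infer_instance⟩

/-- The admissibility structures whose finite limit theory has syntactic category `C` and whose
geometric extension is the one defined by `J`. The 2-functor `Loc` is a sub-2-functor of
`E ↦ Arrow T[E]`, i.e. a class of arrows in each `T[E]` such that these classes are preserved by
inverse images (the action on geometric transformations is then induced, as `Loc[E]` is a full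
subcategory of `Arrow T[E]`). -/
structure IsAdmissibilityStructure (J : GrothendieckTopology C)
    (Loc : ∀ (E : Type (u + 1)) [Category.{u} E] [IsGrothendieckTopos E],
      MorphismProperty (C ⥤ₗ E)) : Prop where
  inverse_image : ∀ (F E : Type (u + 1)) [Category.{u} F] [Category.{u} E]
    [IsGrothendieckTopos F] [IsGrothendieckTopos E] (g : GeometricMorphism F E)
    ⦃M N : C ⥤ₗ E⦄ (v : M ⟶ N), Loc E v → Loc F ((g.inverseImage C).map v)
  iso : ∀ (E : Type (u + 1)) [Category.{u} E] [IsGrothendieckTopos E]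
    ⦃M N : C ⥤ₗ E⦄ (v : M ⟶ N), IsIso v → Loc E v
  left_cancel : ∀ (E : Type (u + 1)) [Category.{u} E] [IsGrothendieckTopos E]
    ⦃M N P : C ⥤ₗ E⦄ (f : M ⟶ N) (v : N ⟶ P), Loc E v → Loc E (f ≫ v) → Loc E f
  /-- Every `f` with target a model of the extension has a factorization through a model of the
  extension followed by an arrow in `Loc`, initial among all factorizations of `f` whose second
  part is in `Loc`. -/
  factorization : ∀ (E : Type (u + 1)) [Category.{u} E] [IsGrothendieckTopos E]
    ⦃M N : C ⥤ₗ E⦄ (f : M ⟶ N), IsExtensionModel J N →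
    ∃ (H : C ⥤ₗ E) (n : M ⟶ H) (v : H ⟶ N),
      Loc E v ∧ IsExtensionModel J H ∧ n ≫ v = f ∧
      ∀ (K : C ⥤ₗ E) (a : M ⟶ K) (w : K ⟶ N), Loc E w → a ≫ w = f →
        ∃! h : H ⟶ K, n ≫ h = a ∧ h ≫ w = v

namespace Geometry

variable [HasFiniteLimits C] (G : Geometry C)

/-- The arrows `y ⟶ x` of the syntactic category which are dual to a map `K_x ⟶ K_y` in `V`. -/
def dualClass : MorphismProperty C :=
  fun _ _ f => G.V ((presentedModel C).map f.op)

/-- The category `Vᵒᵖ`: the full subcategory of `Arrow C` on the duals of maps in `V`. -/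
abbrev VOp : Type u :=
  ObjectProperty.FullSubcategory (fun a : Arrow C => G.dualClass a.hom)

lemma dualClass_id (c : C) : G.dualClass (𝟙 c) := by
  have h := isFinitelyPresentable_presentedModel c
  exact G.saturated.iso _ h h inferInstance

/-- The functor `C ⥤ Vᵒᵖ` sending an object to its identity. -/
def idVOp : C ⥤ G.VOp :=
  ObjectProperty.lift _
    { obj := fun c => Arrow.mk (𝟙 c)
      map := fun f => Arrow.homMk f f (by simp) }
    (fun c => G.dualClass_id c)

/-- The functor `Vᵒᵖ ⥤ C` sending (the dual of) a map in `V` to (the dual of) its codomain. -/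
def codVOp : G.VOp ⥤ C :=
  ObjectProperty.ι _ ⋙ Arrow.leftFunc

variable {E : Type (u + 1)} [Category.{u} E]

/-- The arrow `f : M ⟶ N` of `T[E]` is the one that corresponds to the finite limit preserving
functor `P : Vᵒᵖ ⥤ E` (equivalently, to a geometric morphism `E ⟶ [V, Set]`): it is the composite of
the geometric morphism with the generic arrow. Explicitly, `M` is the restriction of `P` to
identities, `N` is the left Kan extension of `P` along the codomain functor, and `f` is the unit at
identities. -/
def Classifies (P : G.VOp ⥤ₗ E) {M N : C ⥤ₗ E} (f : M ⟶ N) : Prop :=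
  ∃ (i : M.obj ≅ G.idVOp ⋙ P.obj) (α : P.obj ⟶ G.codVOp ⋙ N.obj),
    N.obj.IsLeftKanExtension α ∧
    ∀ c : C, f.hom.app c = i.hom.app c ≫ α.app (G.idVOp.obj c)

variable (E)

/-- The class `Et[E]` of etale arrows in `T[E]`: the arrows that correspond to an object of
`Lex[Vᵒᵖ, E]`. -/
def Et : MorphismProperty (C ⥤ₗ E) :=
  fun _ _ f => ∃ P : G.VOp ⥤ₗ E, G.Classifies P f

/-- The class `Loc[E]` of local arrows in `T[E]`: the transformations whose naturality squares at
the duals of maps in `V` are pullbacks. -/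
def Loc : MorphismProperty (C ⥤ₗ E) :=
  fun M N v => ∀ ⦃y x : C⦄ (w : y ⟶ x), G.dualClass w →
    IsPullback (v.hom.app y) (M.obj.map w) (N.obj.map w) (v.hom.app x)

/-- `Et[E]` as a full subcategory of `Arrow T[E]`. -/
abbrev EtCat : Type (u + 1) :=
  ObjectProperty.FullSubcategory (fun a : Arrow (C ⥤ₗ E) => G.Et E a.hom)

/-- `Loc[E]` as a full subcategory of `Arrow T[E]`. -/
abbrev LocCat : Type (u + 1) :=
  ObjectProperty.FullSubcategory (fun a : Arrow (C ⥤ₗ E) => G.Loc E a.hom)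

/-- The inclusion of `Et[E]` in `Arrow T[E]`. -/
abbrev etIncl : G.EtCat E ⥤ Arrow (C ⥤ₗ E) := ObjectProperty.ι _

/-- The inclusion of `Loc[E]` in `Arrow T[E]`. -/
abbrev locIncl : G.LocCat E ⥤ Arrow (C ⥤ₗ E) := ObjectProperty.ι _

end Geometry

end FiniteLimitTheory

/-! ### Elements of left Kan extensions of left exact set-valued functors. -/

section ElementwiseLan

variable {A : Type u} [SmallCategory A] {C : Type u} [SmallCategory C]

/-! An object `w : y ⟶ x` of `G.VOp` is the dual of a map in `V`; `codVOp` sends it to `y` and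
`domVOp` to `x`. An arrow `f : M ⟶ N` of models has a functor of squares `P(w) = M(x) ×_{N(x)}
N(y)`, which is left exact and restricts to `M` on identities. Its left Kan extension `H` along
`codVOp` factors `f` as `M ⟶ H ⟶ N`, where the first arrow is etale by construction.

That the second arrow is local rests on a computation in sets. As `P` is left exact, its category of
elements is cofiltered, so an element of `H(c)` is a pair of some `p ∈ P(w)` and `t : y ⟶ c`, and
two pairs agree iff they agree after a common refinement. From this and the closure properties of
`V` it follows that `H` is left exact, that its unit is cartesian, and that `H ⟶ N` is local. These
facts pass to presheaves sectionwise, and to a topos through a left exact reflection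
(`exists_leftKanExtension`).

Orthogonality: if `r : Z ⟶ W` is local then `Z(y) = W(y) ×_{W(x)} Z(x)`, so a square from an etale
arrow to `r` induces a map `P ⟶ codVOp ⋙ Z`, which descends to the Kan extension
(`existsUnique_lift_of_isLeftKanExtension`).

Inverse images preserve pullbacks and Kan extensions. For direct images, a cartesian unit makes `P`
the functor of squares of the arrow that it classifies, and this pullback is preserved by `g_*`; the
right adjoint on etale arrows is therefore `g_*` followed by taking the etale part. Finally,
continuity goes back along local arrows because covers can be taken in `V`, where naturality squares
are pullbacks, and epimorphic families in a topos are stable under pullback. -/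

lemma exists_equalizing_element [HasFiniteLimits A] (P : A ⥤ Type u) [PreservesFiniteLimits P]
    {a b : A} (g g' : b ⟶ a) (q : P.obj b) (h : P.map g q = P.map g' q) :
    ∃ (c : A) (r : P.obj c) (k : c ⟶ b), P.map k r = q ∧ k ≫ g = k ≫ g' := by
  have hl := (Types.type_equalizer_iff_unique _ (by
    rw [← P.map_comp, ← P.map_comp, equalizer.condition])).1
      ⟨isLimitForkMapOfIsLimit P (equalizer.condition g g') (equalizerIsEqualizer g g')⟩
  obtain ⟨r, hr, -⟩ := hl q h
  exact ⟨_, r, equalizer.ι g g', hr, equalizer.condition g g'⟩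

lemma exists_common_element [HasFiniteLimits A] (P : A ⥤ Type u) [PreservesFiniteLimits P]
    {a a' : A} (p : P.obj a) (p' : P.obj a') :
    ∃ (b : A) (q : P.obj b) (g : b ⟶ a) (g' : b ⟶ a'), P.map g q = p ∧ P.map g' q = p' := by
  have h := (IsPullback.of_hasPullback (terminal.from a) (terminal.from a')).map P
  have ht : IsTerminal (P.obj (⊤_ A)) := terminalIsTerminal.isTerminalObj P
  obtain ⟨q, hq, hq'⟩ := Types.exists_of_isPullback h p p' (by
    have : Subsingleton (P.obj (⊤_ A)) := (Types.isTerminalEquivUnique _ ht).instSubsingleton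
    exact Subsingleton.elim _ _)
  exact ⟨_, q, _, _, hq, hq'⟩

/-- An elementwise description of the left Kan extension of a finite limit preserving
set-valued functor. -/
structure ElementwiseLan {P : A ⥤ Type u} {F : A ⥤ C} {N : C ⥤ Type u} (α : P ⟶ F ⋙ N) :
    Prop where
  surj : ∀ {c : C} (x : N.obj c), ∃ (a : A) (p : P.obj a) (t : F.obj a ⟶ c),
    N.map t (α.app a p) = x
  eq : ∀ {a a' : A} {c : C} (p : P.obj a) (p' : P.obj a') (t : F.obj a ⟶ c) (t' : F.obj a' ⟶ c),
    N.map t (α.app a p) = N.map t' (α.app a' p') →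
    ∃ (b : A) (q : P.obj b) (g : b ⟶ a) (g' : b ⟶ a'), P.map g q = p ∧ P.map g' q = p' ∧
      F.map g ≫ t = F.map g' ≫ t'

lemma ElementwiseLan.of_isPointwiseLeftKanExtension [HasFiniteLimits A] {P : A ⥤ Type u}
    [PreservesFiniteLimits P] {F : A ⥤ C} {N : C ⥤ Type u} (α : P ⟶ F ⋙ N)
    (h : (Functor.LeftExtension.mk N α).IsPointwiseLeftKanExtension) : ElementwiseLan α where
  surj {c} x := by
    obtain ⟨j, p, hp⟩ := Types.jointly_surjective_of_isColimit (h c) x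
    exact ⟨j.left, p, j.hom, hp⟩
  eq {a a' c} p p' t t' e := by
    let K := CostructuredArrow.proj F c ⋙ P
    -- Having a common refinement is already transitive, since `P` preserves pullbacks. Hence it
    -- contains the equivalence relation that defines the colimit.
    let r : (Σ j, K.obj j) → (Σ j, K.obj j) → Prop := fun x y =>
      ∃ (b : A) (q : P.obj b) (g : b ⟶ x.1.left) (g' : b ⟶ y.1.left),
        P.map g q = x.2 ∧ P.map g' q = y.2 ∧ F.map g ≫ x.1.hom = F.map g' ≫ y.1.hom
    have hr : Equivalence r := by
      refine ⟨fun x => ⟨x.1.left, x.2, 𝟙 _, 𝟙 _, P.map_id_apply _ _,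
        P.map_id_apply _ _, rfl⟩, ?_, ?_⟩
      · rintro x y ⟨b, q, g, g', h₁, h₂, h₃⟩
        exact ⟨b, q, g', g, h₂, h₁, h₃.symm⟩
      · rintro x y z ⟨b, q, g, g', h₁, h₂, h₃⟩ ⟨b', q', k, k', h₄, h₅, h₆⟩
        obtain ⟨s, hs, hs'⟩ := Types.exists_of_isPullback
          ((IsPullback.of_hasPullback g' k).map P) q q' (h₂.trans h₄.symm)
        refine ⟨_, s, pullback.fst g' k ≫ g, pullback.snd g' k ≫ k', ?_, ?_, ?_⟩
        · rw [P.map_comp, comp_apply, hs, h₁]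
        · rw [P.map_comp, comp_apply, hs', h₅]
        · rw [F.map_comp, F.map_comp, Category.assoc, Category.assoc, h₃, ← h₆,
            ← F.map_comp_assoc, ← F.map_comp_assoc, pullback.condition]
    have hle : ∀ x y, K.ColimitTypeRel x y → r x y := by
      rintro ⟨j, x⟩ ⟨j', y⟩ ⟨f, hf⟩
      exact ⟨j.left, x, 𝟙 _, f.left, P.map_id_apply _ _, hf.symm, by
        rw [F.map_id, Category.id_comp, CostructuredArrow.w]⟩
    have key : r ⟨CostructuredArrow.mk t, p⟩ ⟨CostructuredArrow.mk t', p'⟩ := by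
      have h₁ : colimit.ι K (CostructuredArrow.mk t) p =
          colimit.ι K (CostructuredArrow.mk t') p' := by
        let i := (h c).coconePointUniqueUpToIso (colimit.isColimit K)
        have hi := fun j => (h c).comp_coconePointUniqueUpToIso_hom (colimit.isColimit K) j
        have e₁ := ConcreteCategory.congr_hom (hi (CostructuredArrow.mk t)) p
        have e₂ := ConcreteCategory.congr_hom (hi (CostructuredArrow.mk t')) p'
        refine e₁.symm.trans (Eq.trans ?_ e₂)
        exact congrArg i.hom e
      have h₂ := Types.colimit_eq h₁
      have h₃ := h₂.mono hle
      rwa [hr.eqvGen_iff] at h₃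
    exact key

variable {P : A ⥤ Type u} {F : A ⥤ C} {N : C ⥤ Type u} {α : P ⟶ F ⋙ N}

lemma map_app_refine {a b : A} (g : b ⟶ a) (q : P.obj b) {c : C} (t : F.obj a ⟶ c) :
    N.map t (α.app a (P.map g q)) = N.map (F.map g ≫ t) (α.app b q) := by
  have := ConcreteCategory.congr_hom (α.naturality g) q
  simp only [comp_apply, Functor.comp_map] at this
  rw [this, N.map_comp, comp_apply]

lemma ElementwiseLan.eq_same [HasFiniteLimits A] [PreservesFiniteLimits P]
    (h : ElementwiseLan α) {a : A} {c : C} (p : P.obj a) (t t' : F.obj a ⟶ c)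
    (e : N.map t (α.app a p) = N.map t' (α.app a p)) :
    ∃ (b : A) (q : P.obj b) (g : b ⟶ a), P.map g q = p ∧ F.map g ≫ t = F.map g ≫ t' := by
  obtain ⟨b, q, g, g', h₁, h₂, h₃⟩ := h.eq p p t t' e
  -- The refinements `g` and `g'` may differ; both send `q` to `p`, so a further refinement
  -- equalizes them.
  obtain ⟨d, r, k, h₄, h₅⟩ := exists_equalizing_element P g g' q (h₁.trans h₂.symm)
  refine ⟨d, r, k ≫ g, by rw [P.map_comp, comp_apply, h₄, h₁], ?_⟩
  conv_rhs => rw [h₅]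
  rw [F.map_comp, F.map_comp, Category.assoc, Category.assoc, h₃]

lemma ElementwiseLan.surj₂ [HasFiniteLimits A] [PreservesFiniteLimits P]
    (h : ElementwiseLan α) {c c' : C} (x : N.obj c) (x' : N.obj c') :
    ∃ (a : A) (p : P.obj a) (t : F.obj a ⟶ c) (t' : F.obj a ⟶ c'),
      N.map t (α.app a p) = x ∧ N.map t' (α.app a p) = x' := by
  obtain ⟨a, p, t, rfl⟩ := h.surj x
  obtain ⟨a', p', t', rfl⟩ := h.surj x'
  obtain ⟨b, q, g, g', rfl, rfl⟩ := exists_common_element P p p'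
  exact ⟨b, q, F.map g ≫ t, F.map g' ≫ t', (map_app_refine ..).symm, (map_app_refine ..).symm⟩

/-- Two elements can be represented over one `p`. Equations between them become, after refining `p`,
equations between arrows of `C`, to which the pullback property in `C` applies. -/
lemma ElementwiseLan.isPullback_map [HasFiniteLimits A] [PreservesFiniteLimits P]
    (h : ElementwiseLan α) {c c₁ c₂ c₃ : C} {p₁ : c ⟶ c₁} {p₂ : c ⟶ c₂} {r₁ : c₁ ⟶ c₃}
    {r₂ : c₂ ⟶ c₃} (hc : IsPullback p₁ p₂ r₁ r₂) :
    IsPullback (N.map p₁) (N.map p₂) (N.map r₁) (N.map r₂) := by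
  rw [Types.isPullback_iff]
  refine ⟨by rw [← N.map_comp, ← N.map_comp, hc.w], ?_, ?_⟩
  · rintro x y ⟨e₁, e₂⟩
    obtain ⟨a, p, t, t', rfl, rfl⟩ := h.surj₂ x y
    rw [← Functor.map_comp_apply, ← Functor.map_comp_apply] at e₁
    obtain ⟨b, q, g, rfl, h₁⟩ := h.eq_same p _ _ e₁
    rw [map_app_refine, map_app_refine] at e₂ ⊢
    rw [← Functor.map_comp_apply, ← Functor.map_comp_apply] at e₂
    obtain ⟨d, r, k, rfl, h₂⟩ := h.eq_same q _ _ e₂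
    rw [map_app_refine, map_app_refine]
    congr 3
    refine hc.hom_ext ?_ ?_
    · simp only [Category.assoc, h₁]
    · simpa only [Category.assoc] using h₂
  · intro x y e
    obtain ⟨a, p, t, t', rfl, rfl⟩ := h.surj₂ x y
    rw [← Functor.map_comp_apply, ← Functor.map_comp_apply] at e
    obtain ⟨b, q, g, rfl, h₁⟩ := h.eq_same p _ _ e
    simp only [← Category.assoc] at h₁
    refine ⟨N.map (hc.lift _ _ h₁) (α.app b q), ?_, ?_⟩
    · rw [← comp_apply, ← N.map_comp, hc.lift_fst, map_app_refine]
    · rw [← comp_apply, ← N.map_comp, hc.lift_snd, map_app_refine]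

lemma ElementwiseLan.preservesFiniteLimits [HasFiniteLimits A] [HasFiniteLimits C]
    [PreservesFiniteLimits P] (h : ElementwiseLan α) : PreservesFiniteLimits N := by
  have h₁ : PreservesLimitsOfShape (Discrete.{0} PEmpty) N := by
    have : PreservesLimit (Functor.empty.{0} C) N := by
      refine preservesTerminal_of_iso N ?_
      have hA : IsTerminal (P.obj (⊤_ A)) := terminalIsTerminal.isTerminalObj P
      have : Unique (P.obj (⊤_ A)) := Types.isTerminalEquivUnique _ hA
      refine IsTerminal.uniqueUpToIso ((Types.isTerminalEquivUnique _).symm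
        { default := N.map (terminal.from _) (α.app (⊤_ A) default)
          uniq := fun x => ?_ }) terminalIsTerminal
      obtain ⟨a, p, t, rfl⟩ := h.surj x
      rw [← Subsingleton.elim (P.map (terminal.from a) p) default, map_app_refine]
      congr 3
      exact Subsingleton.elim _ _
    exact preservesLimitsOfShape_pempty_of_preservesTerminal N
  have h₂ : PreservesLimitsOfShape WalkingCospan N := by
    refine ⟨fun {K} => ?_⟩
    have : PreservesLimit (cospan (K.map WalkingCospan.Hom.inl) (K.map WalkingCospan.Hom.inr)) N :=
      preservesLimit_of_preserves_limit_cone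
        (IsPullback.of_hasPullback _ _).isLimit
        ((isLimitMapConePullbackConeEquiv N pullback.condition).symm
          (h.isPullback_map (IsPullback.of_hasPullback _ _)).isLimit)
    exact preservesLimit_of_iso_diagram N (diagramIsoCospan K).symm
  exact preservesFiniteLimits_of_preservesTerminal_and_pullbacks N

end ElementwiseLan

/-! ### Duals of maps in `V`, and finite limits in `Vᵒᵖ`. -/

section FiniteLimitTheory

variable (C : Type u) [SmallCategory C]

/-- The Yoneda lemma: maps from the model presented by an object to `M` are the elements of the
value of `M` at this object. -/
noncomputable def presentedModelOpCompYonedaIso (M : C ⥤ₗ Type u) :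
    (presentedModel C).op ⋙ yoneda.obj M ≅ (opOpEquivalence C).functor ⋙ M.obj :=
  NatIso.ofComponents
    (fun X => (((leftExactFunctor C (Type u)).fullyFaithfulι.homEquiv
      (X := (presentedModel C).obj X.unop) (Y := M)).trans coyonedaEquiv).toIso)
    (fun {X Y} f => by
      ext g
      have := (ConcreteCategory.congr_hom (g.hom.naturality f.unop.unop) (𝟙 X.unop.unop))
      refine Eq.trans ?_ this
      change g.hom.app Y.unop.unop (f.unop.unop ≫ 𝟙 _) = g.hom.app _ (𝟙 _ ≫ f.unop.unop)
      rw [Category.comp_id, Category.id_comp])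

/-- By Yoneda, maps from presented models into `M` are the values of `M`, and `M` is left exact. -/
instance [HasFiniteLimits C] : PreservesFiniteColimits (presentedModel C) where
  preservesFiniteColimits I _ _ := ⟨fun {K} => ⟨fun {c} hc => ⟨by
    refine (Cocone.isColimitYonedaEquiv _).symm fun M => ?_
    have : PreservesFiniteLimits M.obj := M.property
    have : PreservesFiniteLimits ((presentedModel C).op ⋙ yoneda.obj M) :=
      preservesFiniteLimits_of_natIso (presentedModelOpCompYonedaIso C M).symm
    exact isLimitOfPreserves ((presentedModel C).op ⋙ yoneda.obj M) hc.op⟩⟩⟩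

variable {C}

lemma preservesFiniteLimits_arrowLeftFunc [HasFiniteLimits C] :
    PreservesFiniteLimits (Arrow.leftFunc : Arrow C ⥤ C) where
  preservesFiniteLimits _ _ _ := ⟨fun {K} =>
    preservesLimit_of_preserves_limit_cone
      (F := (Comma.fst (𝟭 C) (𝟭 C)))
      (Comma.coneOfPreservesIsLimit (L := 𝟭 C) (R := 𝟭 C) K (limit.isLimit _) (limit.isLimit _))
      (limit.isLimit _)⟩

lemma preservesFiniteLimits_arrowRightFunc [HasFiniteLimits C] :
    PreservesFiniteLimits (Arrow.rightFunc : Arrow C ⥤ C) where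
  preservesFiniteLimits _ _ _ := ⟨fun {K} =>
    preservesLimit_of_preserves_limit_cone
      (F := (Comma.snd (𝟭 C) (𝟭 C)))
      (Comma.coneOfPreservesIsLimit (L := 𝟭 C) (R := 𝟭 C) K (limit.isLimit _) (limit.isLimit _))
      (limit.isLimit _)⟩

namespace Geometry

variable [HasFiniteLimits C] (G : Geometry C)

lemma dualClass_comp {x y z : C} {f : x ⟶ y} {g : y ⟶ z} (hf : G.dualClass f)
    (hg : G.dualClass g) : G.dualClass (f ≫ g) := by
  unfold dualClass at *
  rw [op_comp, Functor.map_comp]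
  exact G.saturated.comp _ _ hg hf

lemma dualClass_of_comp {x y z : C} {f : x ⟶ y} {g : y ⟶ z} (hg : G.dualClass g)
    (hfg : G.dualClass (f ≫ g)) : G.dualClass f := by
  unfold dualClass at *
  rw [op_comp, Functor.map_comp] at hfg
  exact G.saturated.right_cancel _ _ hg hfg

lemma dualClass_of_isPullback {x y x' y' : C} {f' : y' ⟶ x'} {a' : y' ⟶ y} {a : x' ⟶ x}
    {f : y ⟶ x} (h : IsPullback f' a' a f) (hf : G.dualClass f) : G.dualClass f' :=
  G.saturated.pushout _ _ _ _ hf (isFinitelyPresentable_presentedModel x')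
    (h.flip.op.flip.map (presentedModel C))

lemma dualClass_fst {x y z : C} (a : y ⟶ x) (f : z ⟶ x) (hf : G.dualClass f) :
    G.dualClass (pullback.fst a f) :=
  G.dualClass_of_isPullback (IsPullback.of_hasPullback a f) hf

/-- The diagonal of `e` is a section of a projection in the class, hence in the class by
cancellation; the equalizer is its pullback along `(t, t')`. -/
lemma dualClass_equalizer {x y z : C} (e : x ⟶ y) (he : G.dualClass e) (t t' : z ⟶ x)
    (h : t ≫ e = t' ≫ e) : G.dualClass (equalizer.ι t t') := by
  have hd : G.dualClass (pullback.lift (𝟙 x) (𝟙 x) rfl : x ⟶ pullback e e) :=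
    G.dualClass_of_comp (g := pullback.fst e e) (G.dualClass_fst e e he)
      (by rw [pullback.lift_fst]; exact G.dualClass_id x)
  refine G.dualClass_of_isPullback (a := pullback.lift t t' h) (a' := equalizer.ι t t' ≫ t)
    ⟨⟨?_⟩, ⟨PullbackCone.IsLimit.mk _ (fun s => equalizer.lift s.fst ?_) ?_ ?_ ?_⟩⟩ hd
  · apply pullback.hom_ext
    · simp only [Category.assoc, pullback.lift_fst, Category.comp_id]
    · simp only [Category.assoc, pullback.lift_snd, Category.comp_id]
      exact (equalizer.condition t t').symm
  · have h₁ := s.condition =≫ pullback.fst _ _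
    have h₂ := s.condition =≫ pullback.snd _ _
    simp only [Category.assoc, pullback.lift_fst, pullback.lift_snd] at h₁ h₂
    rw [h₁, h₂]
  · intro s
    simp
  · intro s
    have h₁ := s.condition =≫ pullback.fst _ _
    simp only [Category.assoc, pullback.lift_fst, Category.comp_id] at h₁
    rw [equalizer.lift_ι_assoc, h₁]
  · intro s m h₁ h₂
    apply equalizer.hom_ext
    simpa using h₁

/-- `presentedModel` turns a finite limit of arrows of `C` into a finite colimit of arrows of
models, and `V` is closed under these. -/
instance isClosedUnderLimitsOfShape_dualClass (J : Type) [SmallCategory J] [FinCategory J] :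
    ObjectProperty.IsClosedUnderLimitsOfShape
      (fun a : Arrow C => G.dualClass a.hom) J := by
  constructor
  rintro X ⟨p⟩
  have := preservesFiniteLimits_arrowLeftFunc (C := C)
  have := preservesFiniteLimits_arrowRightFunc (C := C)
  have h := (G.saturated.finite_colimits Jᵒᵖ).condition
  have hl := isColimitOfPreserves (presentedModel C)
    (isLimitOfPreserves Arrow.leftFunc p.isLimit).op
  have hr := isColimitOfPreserves (presentedModel C)
    (isLimitOfPreserves Arrow.rightFunc p.isLimit).op
  exact h _ _ _ _ hr hl
    (Functor.whiskerRight (NatTrans.op (Functor.whiskerLeft p.diag Arrow.leftToRight))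
      (presentedModel C))
    (fun j => p.prop_diag_obj j.unop) ((presentedModel C).map X.hom.op)
    (fun j => by
      have := (p.π.app j.unop).w
      have e := congrArg (fun f => (presentedModel C).map (Quiver.Hom.op f)) this.symm
      simp only [op_comp, Functor.map_comp] at e
      exact e)

instance : HasFiniteLimits G.VOp := ⟨fun _ _ _ => inferInstance⟩

/-- The functor `Vᵒᵖ ⥤ C` sending (the dual of) a map in `V` to (the dual of) its domain. -/
def domVOp : G.VOp ⥤ C :=
  ObjectProperty.ι _ ⋙ Arrow.rightFunc

/-- The natural transformation whose components are the duals of the maps in `V`. -/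
def codToDom : G.codVOp ⟶ G.domVOp :=
  Functor.whiskerLeft _ Arrow.leftToRight

instance : PreservesFiniteLimits (ObjectProperty.ι (fun a : Arrow C => G.dualClass a.hom)) :=
  ⟨fun _ _ _ => inferInstance⟩

instance : PreservesFiniteLimits G.codVOp := by
  have := preservesFiniteLimits_arrowLeftFunc (C := C)
  unfold codVOp
  infer_instance

instance : PreservesFiniteLimits G.domVOp := by
  have := preservesFiniteLimits_arrowRightFunc (C := C)
  unfold domVOp
  infer_instance

/-- Every object of `Vᵒᵖ` maps to the identity of its domain. -/
def unitIdVOp : 𝟭 G.VOp ⟶ G.domVOp ⋙ G.idVOp where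
  app w := ObjectProperty.homMk (Arrow.homMk w.obj.hom (𝟙 _) (by simp [idVOp]; rfl))
  naturality w w' f := by
    ext
    · exact f.hom.w
    · exact (Category.comp_id _).trans (Category.id_comp _).symm

end Geometry

end FiniteLimitTheory

/-! ### Set-valued Kan extensions along the codomain functor. -/

namespace Geometry

variable {C : Type u} [SmallCategory C] [HasFiniteLimits C] (G : Geometry C)

variable {G} in
/-- The object of `Vᵒᵖ` obtained by precomposition with the dual of a map in `V`. -/
def precompVOp (w : G.VOp) {y : C} (i : y ⟶ G.codVOp.obj w) (hi : G.dualClass i) : G.VOp :=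
  ⟨Arrow.mk (i ≫ w.obj.hom), G.dualClass_comp hi w.property⟩

variable {G} in
/-- The projection from `precompVOp`. -/
def precompVOpHom (w : G.VOp) {y : C} (i : y ⟶ G.codVOp.obj w) (hi : G.dualClass i) :
    precompVOp w i hi ⟶ w :=
  ObjectProperty.homMk (Arrow.homMk i (𝟙 _) (Category.comp_id _).symm)

variable {G} in
lemma VOp.hom_ext {w w' : G.VOp} {f g : w ⟶ w'} (h₁ : G.codVOp.map f = G.codVOp.map g)
    (h₂ : G.domVOp.map f = G.domVOp.map g) : f = g :=
  ObjectProperty.hom_ext _ (Arrow.hom_ext _ _ h₁ h₂)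

section

variable {E : Type (u + 1)} [Category.{u} E]

/-- The functor `P` on `Vᵒᵖ` sends the dual `w : y ⟶ x` of a map in `V` to the pullback of
`f.app x` and `N.map w`. -/
def IsPullbackCone {M N : C ⥤ E} (f : M ⟶ N) {P : G.VOp ⥤ E} (β : P ⟶ G.domVOp ⋙ M)
    (α : P ⟶ G.codVOp ⋙ N) : Prop :=
  ∀ w : G.VOp, IsPullback (β.app w) (α.app w) (f.app (G.domVOp.obj w)) (N.map w.obj.hom)

/-- The naturality squares of `α` at the morphisms `unitIdVOp` are pullbacks. -/
def IsCartesianUnit {P : G.VOp ⥤ E} {N : C ⥤ E} (α : P ⟶ G.codVOp ⋙ N) : Prop :=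
  ∀ w : G.VOp, IsPullback (P.map (G.unitIdVOp.app w)) (α.app w)
    (α.app (G.idVOp.obj (G.domVOp.obj w))) (N.map w.obj.hom)

/-- The naturality squares of `v` at the duals of maps in `V` are pullbacks. -/
def IsLocalTrans {M N : C ⥤ E} (v : M ⟶ N) : Prop :=
  ∀ ⦃y x : C⦄ (w : y ⟶ x), G.dualClass w →
    IsPullback (v.app y) (M.map w) (N.map w) (v.app x)

end

section Types

variable {M N N' : C ⥤ Type u} {P : G.VOp ⥤ Type u} {α : P ⟶ G.codVOp ⋙ N}

variable {G} in
-- Precomposing `w` with `i` leaves the factor in `M` unchanged and replaces only the factor in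
-- `N'`.
lemma IsPullbackCone.exists_lift {f : M ⟶ N'} {β : P ⟶ G.domVOp ⋙ M}
    {α' : P ⟶ G.codVOp ⋙ N'} (h : G.IsPullbackCone f β α') (w : G.VOp) (p : P.obj w) {y : C}
    (i : y ⟶ G.codVOp.obj w) (hi : G.dualClass i) (n : N'.obj y) (hn : N'.map i n = α'.app w p) :
    ∃ p' : P.obj (precompVOp w i hi), P.map (precompVOpHom w i hi) p' = p ∧
      α'.app (precompVOp w i hi) p' = n := by
  obtain ⟨p', h₁, h₂⟩ := Types.exists_of_isPullback (h (precompVOp w i hi)) (β.app w p) n (by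
    refine (ConcreteCategory.congr_hom (h w).w p).trans ?_
    exact (congrArg (N'.map w.obj.hom) hn.symm).trans (N'.map_comp_apply i w.obj.hom n).symm)
  refine ⟨p', ?_, h₂⟩
  apply Types.ext_of_isPullback (h w)
  · have e := ConcreteCategory.congr_hom (β.naturality (precompVOpHom w i hi)) p'
    refine e.trans ?_
    refine Eq.trans ?_ h₁
    exact (M.map_id_apply _ _)
  · have e := ConcreteCategory.congr_hom (α'.naturality (precompVOpHom w i hi)) p'
    refine e.trans ?_
    rw [← hn, ← h₂]
    rfl

/-- Injectivity and surjectivity into the pullback both come from refining a representative along an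
arrow of the dual class: an equalizer for the former, a pullback of `e` for the latter. The left
exactness of `N'` supplies the element that `exists_lift` needs. -/
lemma isLocalTrans_of_elementwiseLan [PreservesFiniteLimits P] [PreservesFiniteLimits N']
    (hα : ElementwiseLan α) {f : M ⟶ N'} {β : P ⟶ G.domVOp ⋙ M} {α' : P ⟶ G.codVOp ⋙ N'}
    (h : G.IsPullbackCone f β α') (v : N ⟶ N') (hv : α ≫ Functor.whiskerLeft _ v = α') :
    G.IsLocalTrans v := by
  have hv' : ∀ {w : G.VOp} {c : C} (t : G.codVOp.obj w ⟶ c) (p : P.obj w),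
      v.app c (N.map t (α.app w p)) = N'.map t (α'.app w p) := by
    intro w c t p
    rw [← hv]
    exact ConcreteCategory.congr_hom (v.naturality t) _
  intro c' c e he
  rw [Types.isPullback_iff]
  refine ⟨(v.naturality e).symm, ?_, ?_⟩
  · rintro x y ⟨h₁, h₂⟩
    obtain ⟨w, p, t, t', rfl, rfl⟩ := hα.surj₂ x y
    rw [← Functor.map_comp_apply, ← Functor.map_comp_apply] at h₂
    obtain ⟨w, p, g, rfl, h₃⟩ := hα.eq_same p _ _ h₂
    rw [map_app_refine, map_app_refine] at h₁ ⊢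
    rw [hv', hv'] at h₁
    simp only [← Category.assoc] at h₃
    generalize G.codVOp.map g ≫ t = s, G.codVOp.map g ≫ t' = s' at h₁ h₃ ⊢
    -- The two elements have equal images in `N'`, so the image of `p` lies over the equalizer of
    -- `s` and `s'`; lifting `p` there makes the representatives coincide.
    have hd := G.dualClass_equalizer e he _ _ h₃
    have hl := (Types.type_equalizer_iff_unique _ (by
      rw [← N'.map_comp, ← N'.map_comp, equalizer.condition])).1
        ⟨isLimitForkMapOfIsLimit N' (equalizer.condition s s') (equalizerIsEqualizer s s')⟩
    obtain ⟨n, hn, -⟩ := hl _ h₁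
    obtain ⟨p', rfl, -⟩ := h.exists_lift w p (equalizer.ι s s') hd n hn
    rw [map_app_refine, map_app_refine]
    congr 3
    exact equalizer.condition s s'
  · intro z x hzx
    obtain ⟨w, p, t, rfl⟩ := hα.surj x
    rw [hv'] at hzx
    obtain ⟨n, hn₁, hn₂⟩ := Types.exists_of_isPullback
      ((IsPullback.of_hasPullback t e).map N') _ _ hzx.symm
    obtain ⟨p', rfl, rfl⟩ := h.exists_lift w p (pullback.fst t e) (G.dualClass_fst t e he) n hn₁
    refine ⟨N.map (pullback.snd t e) (α.app _ p'), ?_, ?_⟩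
    · rw [← hn₂]
      exact hv' (w := precompVOp _ _ _) _ p'
    · rw [map_app_refine]
      refine (Functor.map_comp_apply _ _ _ _).symm.trans ?_
      congr 3
      exact (pullback.condition (f := t) (g := e)).symm

/-- A morphism of `Vᵒᵖ` into `w₀` is a pair of compatible arrows into its two ends. The element of
`N` provides one and the element of `P` at the identity provides the other. -/
lemma isCartesianUnit_of_elementwiseLan [PreservesFiniteLimits P] (hα : ElementwiseLan α) :
    G.IsCartesianUnit α := by
  intro w₀
  rw [Types.isPullback_iff]
  refine ⟨α.naturality (G.unitIdVOp.app w₀), ?_, ?_⟩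
  · rintro p p' ⟨h₁, h₂⟩
    obtain ⟨w, q, g, g', rfl, rfl, h₃⟩ := hα.eq p p' (𝟙 _) (𝟙 _) (by
      rw [N.map_id_apply, N.map_id_apply]
      exact h₂)
    rw [← Functor.map_comp_apply, ← Functor.map_comp_apply] at h₁
    obtain ⟨w', r, k, rfl, h₄⟩ := exists_equalizing_element P _ _ q h₁
    rw [← Functor.map_comp_apply, ← Functor.map_comp_apply]
    refine congrArg (fun z => P.map z r) (VOp.hom_ext ?_ ?_)
    · rw [Functor.map_comp, Functor.map_comp]
      exact congrArg (G.codVOp.map k ≫ ·)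
        ((Category.comp_id _).symm.trans (h₃.trans (Category.comp_id _)))
    · have := congrArg G.domVOp.map h₄
      simp only [Functor.map_comp] at this ⊢
      exact (congrArg (G.domVOp.map k ≫ ·) (Category.comp_id (G.domVOp.map g))).symm.trans
        (this.trans (congrArg (G.domVOp.map k ≫ ·) (Category.comp_id (G.domVOp.map g'))))
  · intro m x hx
    obtain ⟨w, q, t, rfl⟩ := hα.surj x
    obtain ⟨w₁, r, g, g', rfl, rfl, h₃⟩ := hα.eq m q (𝟙 _) (t ≫ w₀.obj.hom) (by
      rw [N.map_id_apply]
      exact hx.trans (N.map_comp_apply _ _ _).symm)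
    rw [Category.comp_id] at h₃
    -- The relation `h₃` obtained from the common refinement is what makes this square commute.
    let k : w₁ ⟶ w₀ := ObjectProperty.homMk (Arrow.homMk (G.codVOp.map g' ≫ t) g.hom.right (by
      refine (Category.assoc _ _ _).trans (h₃.symm.trans ?_)
      exact (Category.comp_id _).symm.trans g.hom.w))
    refine ⟨P.map k r, ?_, ?_⟩
    · rw [← Functor.map_comp_apply]
      exact congrArg (fun z => P.map z r) (VOp.hom_ext
        ((Category.assoc _ _ _).trans h₃.symm) (Category.comp_id _))
    · rw [map_app_refine]
      exact ConcreteCategory.congr_hom (α.naturality k) r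

end Types

end Geometry

/-! ### Grothendieck toposes as left exact reflections. -/

namespace IsGrothendieckTopos

variable (E : Type (u + 1)) [Category.{u} E] [IsGrothendieckTopos E]

/-- A Grothendieck topos is a left exact reflective subcategory of a category of presheaves. -/
lemma exists_reflection : ∃ (D : Type u) (_ : SmallCategory D) (L : (Dᵒᵖ ⥤ Type u) ⥤ E)
    (R : E ⥤ Dᵒᵖ ⥤ Type u) (_ : L ⊣ R), R.Full ∧ R.Faithful ∧ PreservesFiniteLimits L := by
  obtain ⟨D, _, K, ⟨e⟩⟩ := exists_site (E := E)
  exact ⟨D, inferInstance, presheafToSheaf K _ ⋙ e.inverse, e.functor ⋙ sheafToPresheaf K _,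
    (sheafificationAdjunction K _).comp e.symm.toAdjunction, inferInstance, inferInstance,
    inferInstance⟩

instance : HasFiniteLimits E := by
  obtain ⟨D, _, K, ⟨e⟩⟩ := exists_site (E := E)
  exact ⟨fun _ _ _ => Adjunction.hasLimitsOfShape_of_equivalence e.functor⟩

instance : Balanced E := by
  obtain ⟨D, _, K, ⟨e⟩⟩ := exists_site (E := E)
  refine ⟨fun f _ _ => ?_⟩
  have := isIso_of_mono_of_epi (e.functor.map f)
  exact isIso_of_reflects_iso f e.functor

end IsGrothendieckTopos

/-! ### Kan extensions of left exact functors with values in a topos. -/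

namespace Geometry

variable {C : Type u} [SmallCategory C] [HasFiniteLimits C] (G : Geometry C)

section Presheaf

variable {D : Type u} [SmallCategory D] (P : G.VOp ⥤ Dᵒᵖ ⥤ Type u) [PreservesFiniteLimits P]

lemma elementwiseLan_pointwiseLeftKanExtensionUnit (d : Dᵒᵖ) :
    ElementwiseLan (P := P ⋙ (evaluation _ _).obj d)
      (N := G.codVOp.pointwiseLeftKanExtension P ⋙ (evaluation _ _).obj d)
      (Functor.whiskerRight (G.codVOp.pointwiseLeftKanExtensionUnit P) ((evaluation _ _).obj d) ≫
        (Functor.associator _ _ _).hom) :=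
  ElementwiseLan.of_isPointwiseLeftKanExtension _
    (Functor.LeftExtension.isPointwiseLeftKanExtensionEquivOfIso
      (Functor.LeftExtension.postcompose₂ObjMkIso _ _)
      ((Functor.pointwiseLeftKanExtensionIsPointwiseLeftKanExtension G.codVOp P).postcompose
        ((evaluation _ _).obj d)))

lemma preservesFiniteLimits_pointwiseLeftKanExtension :
    PreservesFiniteLimits (G.codVOp.pointwiseLeftKanExtension P) :=
  preservesFiniteLimits_of_evaluation _ fun d =>
    (G.elementwiseLan_pointwiseLeftKanExtensionUnit P d).preservesFiniteLimits

lemma isCartesianUnit_pointwiseLeftKanExtensionUnit :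
    G.IsCartesianUnit (G.codVOp.pointwiseLeftKanExtensionUnit P) := fun w =>
  IsPullback.of_forall_isPullback_app fun d => by
    have h := G.isCartesianUnit_of_elementwiseLan
      (G.elementwiseLan_pointwiseLeftKanExtensionUnit P d) w
    simp only [NatTrans.comp_app, Functor.associator_hom_app, Category.comp_id] at h
    exact h

variable {P} in
lemma isLocalTrans_of_pointwiseLeftKanExtension {M N : C ⥤ Dᵒᵖ ⥤ Type u}
    [PreservesFiniteLimits N] {f : M ⟶ N} {β : P ⟶ G.domVOp ⋙ M} {α : P ⟶ G.codVOp ⋙ N}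
    (h : G.IsPullbackCone f β α) (v : G.codVOp.pointwiseLeftKanExtension P ⟶ N)
    (hv : G.codVOp.pointwiseLeftKanExtensionUnit P ≫ Functor.whiskerLeft _ v = α) :
    G.IsLocalTrans v := fun _ _ e he =>
  IsPullback.of_forall_isPullback_app fun d =>
    G.isLocalTrans_of_elementwiseLan (N' := N ⋙ (evaluation _ _).obj d)
      (M := M ⋙ (evaluation _ _).obj d)
      (G.elementwiseLan_pointwiseLeftKanExtensionUnit P d)
      (f := Functor.whiskerRight f _)
      (β := Functor.whiskerRight β _ ≫ (Functor.associator _ _ _).hom)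
      (α' := Functor.whiskerRight α _ ≫ (Functor.associator _ _ _).hom)
      (fun w => by
        simp only [NatTrans.comp_app, Functor.associator_hom_app, Category.comp_id]
        exact (h w).app d)
      (Functor.whiskerRight v _) (by
        rw [← hv]
        ext
        simp) e he

end Presheaf

variable {E : Type (u + 1)} [Category.{u} E] [IsGrothendieckTopos E]

/-- The left Kan extension of a finite limit preserving functor `Vᵒᵖ ⥤ E` along the codomain
functor is a model, with a cartesian unit, and if the functor comes from an arrow `f` of models
then the arrow from the Kan extension to the codomain of `f` is local. -/
theorem exists_leftKanExtension (P : G.VOp ⥤ E) [PreservesFiniteLimits P] :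
    ∃ (N : C ⥤ₗ E) (α : P ⟶ G.codVOp ⋙ N.obj), N.obj.IsLeftKanExtension α ∧
      G.IsCartesianUnit α ∧
      ∀ (M N' : C ⥤ E) [PreservesFiniteLimits N'] (f : M ⟶ N') (β : P ⟶ G.domVOp ⋙ M)
        (α' : P ⟶ G.codVOp ⋙ N'), G.IsPullbackCone f β α' →
        ∀ v : N.obj ⟶ N', α ≫ Functor.whiskerLeft _ v = α' → G.IsLocalTrans v := by
  obtain ⟨D, _, L, R, adj, _, _, _⟩ := IsGrothendieckTopos.exists_reflection E
  have := adj.rightAdjoint_preservesLimits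
  have := adj.leftAdjoint_preservesColimits
  let Q := P ⋙ R
  let N₀ := G.codVOp.pointwiseLeftKanExtension Q
  let α₀ : Q ⟶ G.codVOp ⋙ N₀ := G.codVOp.pointwiseLeftKanExtensionUnit Q
  have hN₀ : PreservesFiniteLimits N₀ := G.preservesFiniteLimits_pointwiseLeftKanExtension Q
  have hL : (N₀ ⋙ L).IsLeftKanExtension
      (Functor.whiskerRight α₀ L ≫ (Functor.associator _ _ _).hom) :=
    Functor.PreservesLeftKanExtension.preserves N₀ α₀
  -- `R` is fully faithful, so the counit is invertible and `P` is the reflection of `P ⋙ R`.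
  let i : P ≅ Q ⋙ L := (Functor.rightUnitor P).symm ≪≫
    Functor.isoWhiskerLeft P (asIso adj.counit).symm ≪≫ (Functor.associator _ _ _).symm
  let α : P ⟶ G.codVOp ⋙ N₀ ⋙ L :=
    i.hom ≫ Functor.whiskerRight α₀ L ≫ (Functor.associator _ _ _).hom
  have hα : ∀ w, α.app w = inv (adj.counit.app (P.obj w)) ≫ L.map (α₀.app w) := fun w => by
    simp [α, i]
  refine ⟨⟨N₀ ⋙ L, by rw [leftExactFunctor_iff]; infer_instance⟩, α,
    (Functor.isLeftKanExtension_iff_of_iso₂ _ _ i (Iso.refl _) (by simp [α])).2 hL, fun w => ?_, ?_⟩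
  · refine IsPullback.of_iso ((G.isCartesianUnit_pointwiseLeftKanExtensionUnit Q w).map L)
      (asIso (adj.counit.app (P.obj w))) (asIso (adj.counit.app _)) (Iso.refl _) (Iso.refl _)
      ?_ ?_ ?_ ?_
    · exact adj.counit.naturality _
    · rw [hα]; simp [α₀]
    · rw [hα]; simp [α₀]
    · simp; rfl
  · intro M N' _ f β α' h v hv c' c e he
    -- The transpose of `v` is local in presheaves; applying the left exact `L` and the counit gives
    -- back `v`.
    let v₀ : N₀ ⟶ N' ⋙ R :=
      { app := fun c => adj.homEquiv _ _ (v.app c)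
        naturality := fun c c' t => by
          have := v.naturality t
          refine (adj.homEquiv_naturality_left _ _).symm.trans ?_
          exact (congrArg _ this).trans (adj.homEquiv_naturality_right _ _) }
    have hv₀ : G.IsLocalTrans v₀ := by
      refine G.isLocalTrans_of_pointwiseLeftKanExtension (f := Functor.whiskerRight f R)
        (β := Functor.whiskerRight β R ≫ (Functor.associator _ _ _).hom)
        (α := Functor.whiskerRight α' R ≫ (Functor.associator _ _ _).hom)
        (fun w => by
          simp only [NatTrans.comp_app, Functor.associator_hom_app, Category.comp_id]
          exact (h w).map R) v₀ ?_
      ext1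
      ext1 w
      have h₁ : α.app w ≫ v.app _ = α'.app w := congr_app hv w
      rw [hα, Category.assoc, IsIso.inv_comp_eq] at h₁
      refine (adj.homEquiv_naturality_left _ _).symm.trans ?_
      refine (congrArg _ h₁).trans ?_
      simp [Adjunction.homEquiv_unit]
    refine IsPullback.of_iso ((hv₀ e he).map L) (Iso.refl _) (asIso (adj.counit.app _))
      (Iso.refl _) (asIso (adj.counit.app _)) ?_ ?_ ?_ ?_
    · simpa [v₀] using (adj.homEquiv_counit _ _ _).symm.trans
        ((adj.homEquiv _ _).symm_apply_apply (v.app c'))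
    · simp
    · exact adj.counit.naturality (N'.map e)
    · simpa [v₀] using (adj.homEquiv_counit _ _ _).symm.trans
        ((adj.homEquiv _ _).symm_apply_apply (v.app c))

end Geometry

/-! ### Orthogonality, and the functor of squares. -/

lemma preservesFiniteLimits_of_isLimit {I J E : Type*} [Category* I] [Category* J] [Category* E]
    [HasLimitsOfShape I E] {K : I ⥤ J ⥤ E} {c : Cone K} (hc : IsLimit c)
    (hK : ∀ i, PreservesFiniteLimits (K.obj i)) : PreservesFiniteLimits c.pt := by
  -- Limits commute with limits: up to isomorphism `c.pt` is `K.flip ⋙ lim`, a composite of left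
  -- exact functors.
  have : PreservesFiniteLimits K.flip := ⟨fun I' _ _ => ⟨fun {F} => ⟨fun {d} hd =>
    ⟨evaluationJointlyReflectsLimits _ fun i => isLimitOfPreserves (K.obj i) hd⟩⟩⟩⟩
  have : PreservesFiniteLimits (lim : (I ⥤ E) ⥤ E) :=
    ⟨fun _ _ _ => constLimAdj.rightAdjoint_preservesLimits.preservesLimitsOfShape⟩
  have hπ (j i) : ((limit.isLimit (K.flip.obj j)).conePointUniqueUpToIso
      (isLimitOfPreserves ((evaluation _ _).obj j) hc)).hom ≫ (c.π.app i).app j =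
      limit.π (K.flip.obj j) i :=
    IsLimit.conePointUniqueUpToIso_hom_comp _ _ _
  let e : K.flip ⋙ lim ≅ c.pt :=
    NatIso.ofComponents
      (fun j => (limit.isLimit (K.flip.obj j)).conePointUniqueUpToIso
        (isLimitOfPreserves ((evaluation _ _).obj j) hc))
      (fun {j j'} f => by
        apply (isLimitOfPreserves ((evaluation _ _).obj j') hc).hom_ext
        intro i
        simp [hπ, reassoc_of% (hπ j i)])
  exact preservesFiniteLimits_of_natIso e

/-- The pullbacks `hr` combine `α ≫ b` and `β ≫ a` into a map from `P` to `F ⋙ Z`, and this descends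
along `α`. Uniqueness holds because both projections of any solution are forced. -/
lemma existsUnique_lift_of_isLeftKanExtension {A C E : Type*} [Category* A] [Category* C]
    [Category* E] {F D : A ⥤ C} (q : F ⟶ D) {M N Z W : C ⥤ E} {P : A ⥤ E} (α : P ⟶ F ⋙ N)
    [N.IsLeftKanExtension α] (β : P ⟶ D ⋙ M) (f : M ⟶ N)
    (hβ : β ≫ Functor.whiskerLeft D f = α ≫ Functor.whiskerRight q N)
    (hβ' : ∀ {T : C ⥤ E} (g g' : M ⟶ T),
      β ≫ Functor.whiskerLeft D g = β ≫ Functor.whiskerLeft D g' → g = g')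
    {r : Z ⟶ W} (hr : ∀ w, IsPullback (r.app (F.obj w)) (Z.map (q.app w)) (W.map (q.app w))
      (r.app (D.obj w))) (a : M ⟶ Z) (b : N ⟶ W) (h : a ≫ r = f ≫ b) :
    ∃! d : N ⟶ Z, f ≫ d = a ∧ d ≫ r = b := by
  have hβ (w) : β.app w ≫ f.app (D.obj w) = α.app w ≫ N.map (q.app w) := congr_app hβ w
  have h (c) : a.app c ≫ r.app c = f.app c ≫ b.app c := congr_app h c
  have w₁ (w) : (α.app w ≫ b.app (F.obj w)) ≫ W.map (q.app w) =
      (β.app w ≫ a.app (D.obj w)) ≫ r.app (D.obj w) := by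
    simp [h, reassoc_of% (hβ w)]
  let δ : P ⟶ F ⋙ Z :=
    { app := fun w => (hr w).lift _ _ (w₁ w)
      naturality := fun w w' k => by
        apply (hr w').hom_ext
        · simp
        · have := q.naturality k
          simp [← Functor.map_comp, this]
          simp }
  have δ₁ (w) : δ.app w ≫ r.app (F.obj w) = α.app w ≫ b.app (F.obj w) := (hr w).lift_fst _ _ _
  have δ₂ (w) : δ.app w ≫ Z.map (q.app w) = β.app w ≫ a.app (D.obj w) := (hr w).lift_snd _ _ _
  have fac := N.descOfIsLeftKanExtension_fac_app α Z δ
  refine ⟨N.descOfIsLeftKanExtension α Z δ, ⟨hβ' _ _ ?_, ?_⟩, ?_⟩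
  · ext w
    refine Eq.trans ?_ (δ₂ w)
    rw [← fac w]
    simp [reassoc_of% (hβ w)]
  · apply N.hom_ext_of_isLeftKanExtension α
    ext w
    simp [δ₁]
  · rintro d ⟨rfl, rfl⟩
    apply N.hom_ext_of_isLeftKanExtension α
    ext w
    refine Eq.trans ?_ (fac w).symm
    apply (hr w).hom_ext
    · simp [δ₁]
    · simp [δ₂, reassoc_of% (hβ w)]

namespace Geometry

variable {C : Type u} [SmallCategory C] [HasFiniteLimits C] (G : Geometry C)

lemma unitIdVOp_app_idVOp (c : C) : G.unitIdVOp.app (G.idVOp.obj c) = 𝟙 _ :=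
  VOp.hom_ext rfl rfl

section

variable {E : Type (u + 1)} [Category.{u} E]

section

variable [HasPullbacks E] {M N : C ⥤ E} (f : M ⟶ N)

/-- The functor on `Vᵒᵖ` of commutative squares from a map in `V` to `f`. -/
noncomputable def squares : G.VOp ⥤ E :=
  pullback (Functor.whiskerLeft G.domVOp f) (Functor.whiskerRight G.codToDom N)

/-- The projection of `squares` to the domain of `f`. -/
noncomputable def squaresFst : G.squares f ⟶ G.domVOp ⋙ M := pullback.fst _ _

/-- The projection of `squares` to the codomain of `f`. -/
noncomputable def squaresSnd : G.squares f ⟶ G.codVOp ⋙ N := pullback.snd _ _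

lemma isPullbackCone_squares : G.IsPullbackCone f (G.squaresFst f) (G.squaresSnd f) := fun w =>
  (IsPullback.of_hasPullback (Functor.whiskerLeft G.domVOp f)
    (Functor.whiskerRight G.codToDom N)).app w

lemma preservesFiniteLimits_squares [PreservesFiniteLimits M] [PreservesFiniteLimits N] :
    PreservesFiniteLimits (G.squares f) :=
  preservesFiniteLimits_of_isLimit (limit.isLimit _) (by
    rintro (_ | _ | _) <;> dsimp <;> infer_instance)

end

/-- The natural transformation to the domain of the arrow classified by `P`. -/
def classifiedFst {P : G.VOp ⥤ E} {M : C ⥤ E} (i : M ≅ G.idVOp ⋙ P) : P ⟶ G.domVOp ⋙ M where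
  app w := P.map (G.unitIdVOp.app w) ≫ i.inv.app (G.domVOp.obj w)
  naturality w w' k := by
    have h₁ := i.inv.naturality (G.domVOp.map k)
    have h₂ := congrArg P.map (G.unitIdVOp.naturality k)
    simp only [Functor.map_comp, Functor.id_map] at h₂
    refine (Category.assoc _ _ _).symm.trans ?_
    refine (congrArg (· ≫ i.inv.app (G.domVOp.obj w')) h₂).trans ?_
    refine (Category.assoc _ _ _).trans ?_
    exact (congrArg (P.map (G.unitIdVOp.app w) ≫ ·) h₁).trans (Category.assoc _ _ _).symm

lemma classifiedFst_app_idVOp {P : G.VOp ⥤ E} {M : C ⥤ E} (i : M ≅ G.idVOp ⋙ P) (c : C) :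
    (G.classifiedFst i).app (G.idVOp.obj c) = i.inv.app c := by
  dsimp only [classifiedFst]
  rw [unitIdVOp_app_idVOp]
  exact (congrArg (· ≫ i.inv.app c) (P.map_id (G.idVOp.obj c))).trans (Category.id_comp _)

lemma classifiedFst_comp {P : G.VOp ⥤ E} {M N : C ⥤ E} (i : M ≅ G.idVOp ⋙ P)
    (α : P ⟶ G.codVOp ⋙ N) (f : M ⟶ N)
    (hf : ∀ c, f.app c = i.hom.app c ≫ α.app (G.idVOp.obj c)) :
    G.classifiedFst i ≫ Functor.whiskerLeft G.domVOp f = α ≫ Functor.whiskerRight G.codToDom N := by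
  ext w
  refine Eq.trans ?_ (α.naturality (G.unitIdVOp.app w))
  refine (Category.assoc _ _ _).trans (congrArg (P.map (G.unitIdVOp.app w) ≫ ·) ?_)
  exact (congrArg (i.inv.app _ ≫ ·) (hf _)).trans (Iso.inv_hom_id_app_assoc i _ _)

/-- Every object of `C` is the domain of an identity, where `classifiedFst` is invertible. -/
lemma classifiedFst_cancel {P : G.VOp ⥤ E} {M T : C ⥤ E} (i : M ≅ G.idVOp ⋙ P) (g g' : M ⟶ T)
    (h : G.classifiedFst i ≫ Functor.whiskerLeft G.domVOp g =
      G.classifiedFst i ≫ Functor.whiskerLeft G.domVOp g') : g = g' := by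
  ext c
  have := congr_app h (G.idVOp.obj c)
  simp only [NatTrans.comp_app, classifiedFst_app_idVOp] at this
  exact (cancel_epi (i.inv.app c)).1 this

lemma existsUnique_lift_of_classifies {P : G.VOp ⥤ₗ E} {X Y Z W : C ⥤ₗ E} {l : X ⟶ Y} {r : Z ⟶ W}
    (hl : G.Classifies P l) (hr : G.Loc E r) (a : X ⟶ Z) (b : Y ⟶ W) (h : a ≫ r = l ≫ b) :
    ∃! d : Y ⟶ Z, l ≫ d = a ∧ d ≫ r = b := by
  obtain ⟨i, α, hα, hi⟩ := hl
  obtain ⟨d, ⟨h₁, h₂⟩, hd⟩ := existsUnique_lift_of_isLeftKanExtension G.codToDom α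
    (G.classifiedFst i) l.hom (G.classifiedFst_comp i α _ hi) (G.classifiedFst_cancel i)
    (r := r.hom) (fun w => hr _ w.property) a.hom b.hom (congrArg (fun z : X ⟶ W => z.hom) h)
  refine ⟨ObjectProperty.homMk d, ⟨?_, ?_⟩, ?_⟩
  · ext : 1
    exact h₁
  · ext : 1
    exact h₂
  · rintro d' ⟨rfl, rfl⟩
    ext : 1
    exact hd _ ⟨rfl, rfl⟩

end

end Geometry

/-! ### The factorization system. -/

namespace Geometry

variable {C : Type u} [SmallCategory C] [HasFiniteLimits C] (G : Geometry C)
variable {E : Type (u + 1)} [Category.{u} E]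

section

variable {G}

lemma Classifies.of_iso {P P' : G.VOp ⥤ₗ E} {M N : C ⥤ₗ E} {f : M ⟶ N} (h : G.Classifies P f)
    (e : P.obj ≅ P'.obj) : G.Classifies P' f := by
  obtain ⟨i, α, hα, hi⟩ := h
  refine ⟨i ≪≫ Functor.isoWhiskerLeft _ e, e.inv ≫ α,
    (Functor.isLeftKanExtension_iff_of_iso₂ α (e.inv ≫ α) e (Iso.refl _) (by simp)).1 hα, ?_⟩
  intro c
  refine (hi c).trans ?_
  simp
  rfl

lemma Classifies.comp_isIso {P : G.VOp ⥤ₗ E} {M N N' : C ⥤ₗ E} {f : M ⟶ N}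
    (h : G.Classifies P f) (v : N ⟶ N') [IsIso v] : G.Classifies P (f ≫ v) := by
  obtain ⟨i, α, hα, hi⟩ := h
  refine ⟨i, α ≫ Functor.whiskerLeft _ v.hom,
    (Functor.isLeftKanExtension_iff_of_iso₂ α _ (Iso.refl _)
      ((leftExactFunctor C E).ι.mapIso (asIso v)) (by simp)).1 hα, ?_⟩
  intro c
  refine (congrArg (· ≫ v.hom.app c) (hi c)).trans ?_
  exact Category.assoc _ _ _

lemma IsPullbackCone.nonempty_iso {M N : C ⥤ E} {f : M ⟶ N} {P P' : G.VOp ⥤ E}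
    {β : P ⟶ G.domVOp ⋙ M} {α : P ⟶ G.codVOp ⋙ N} (h : G.IsPullbackCone f β α)
    {β' : P' ⟶ G.domVOp ⋙ M} {α' : P' ⟶ G.codVOp ⋙ N} (h' : G.IsPullbackCone f β' α') :
    Nonempty (P ≅ P') :=
  ⟨IsPullback.isoIsPullback _ _
    (IsPullback.of_forall_isPullback_app (f₃ := Functor.whiskerLeft G.domVOp f)
      (f₄ := Functor.whiskerRight G.codToDom N) h)
    (IsPullback.of_forall_isPullback_app (f₃ := Functor.whiskerLeft G.domVOp f)
      (f₄ := Functor.whiskerRight G.codToDom N) h')⟩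

end

lemma loc_of_isIso {M N : C ⥤ₗ E} (f : M ⟶ N) [IsIso f] : G.Loc E f := fun y x w _ => by
  have (c : C) : IsIso (f.hom.app c) :=
    ((leftExactFunctor C E).ι ⋙ (evaluation C E).obj c).map_isIso f
  exact IsPullback.of_horiz_isIso ⟨(f.hom.naturality w).symm⟩

lemma loc_comp {M N P : C ⥤ₗ E} (f : M ⟶ N) (v : N ⟶ P) (hf : G.Loc E f) (hv : G.Loc E v) :
    G.Loc E (f ≫ v) := fun _ _ w hw => (hf w hw).paste_horiz (hv w hw)

lemma loc_of_comp {M N P : C ⥤ₗ E} (f : M ⟶ N) (v : N ⟶ P) (hv : G.Loc E v)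
    (hfv : G.Loc E (f ≫ v)) : G.Loc E f := fun _ _ w hw =>
  IsPullback.of_right (hfv w hw) (f.hom.naturality w).symm (hv w hw)

variable [IsGrothendieckTopos E]

lemma isCartesianUnit_of_isLeftKanExtension (P : G.VOp ⥤ E) [PreservesFiniteLimits P]
    {N : C ⥤ E} (α : P ⟶ G.codVOp ⋙ N) [N.IsLeftKanExtension α] : G.IsCartesianUnit α := by
  obtain ⟨N', α', hα', h, -⟩ := G.exists_leftKanExtension P
  let e := Functor.leftKanExtensionUnique N'.obj α' N α
  have he : ∀ w, α'.app w ≫ e.hom.app _ = α.app w := fun w => by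
    simp [e, Functor.leftKanExtensionUnique]
  intro w
  refine IsPullback.of_iso (h w) (Iso.refl _) (Iso.refl _) (e.app _) (e.app _) ?_ ?_ ?_ ?_
  · exact (Category.comp_id _).trans (Category.id_comp _).symm
  · exact (he w).trans (Category.id_comp _).symm
  · exact (he _).trans (Category.id_comp _).symm
  · exact e.hom.naturality w.obj.hom

variable {G} in
-- Since the unit is cartesian, `P` is recovered up to isomorphism as the functor of squares of `f`.
lemma Classifies.exists_isPullbackCone {P : G.VOp ⥤ₗ E} {M N : C ⥤ₗ E} {f : M ⟶ N}
    (h : G.Classifies P f) : ∃ (β : P.obj ⟶ G.domVOp ⋙ M.obj) (α : P.obj ⟶ G.codVOp ⋙ N.obj),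
      G.IsPullbackCone f.hom β α := by
  obtain ⟨i, α, hα, hi⟩ := h
  refine ⟨G.classifiedFst i, α, fun w => ?_⟩
  refine IsPullback.of_iso (G.isCartesianUnit_of_isLeftKanExtension P.obj α w) (Iso.refl _)
    (i.symm.app _) (Iso.refl _) (Iso.refl _) ?_ ?_ ?_ ?_
  · exact (Category.id_comp _).symm
  · exact (Category.comp_id _).trans (Category.id_comp _).symm
  · refine (Category.comp_id _).trans ?_
    exact (Iso.inv_hom_id_app_assoc i _ _).symm.trans (congrArg (i.inv.app _ ≫ ·) (hi _).symm)
  · exact (Category.comp_id _).trans (Category.id_comp _).symm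

/-- The model of squares from a map in `V` to `f`. -/
noncomputable def squaresModel {M N : C ⥤ₗ E} (f : M ⟶ N) : G.VOp ⥤ₗ E :=
  ⟨G.squares f.hom, G.preservesFiniteLimits_squares f.hom⟩

/-- Every arrow of models is the composite of the etale arrow classified by its squares and a local
arrow. -/
lemma exists_factorization {M N : C ⥤ₗ E} (f : M ⟶ N) :
    ∃ (H : C ⥤ₗ E) (n : M ⟶ H) (v : H ⟶ N),
      G.Classifies (G.squaresModel f) n ∧ G.Loc E v ∧ n ≫ v = f := by
  have := G.preservesFiniteLimits_squares f.hom
  obtain ⟨H, α, hα, -, hloc⟩ := G.exists_leftKanExtension (G.squares f.hom)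
  have hc := G.isPullbackCone_squares f.hom
  -- Over an identity the square is a pullback along `N.obj.map (𝟙 c)`, so squares restrict to `M`
  -- on identities.
  have hiso (c : C) : IsIso ((G.squaresFst f.hom).app (G.idVOp.obj c)) :=
    (hc (G.idVOp.obj c)).isIso_fst_of_isIso (inst := inferInstanceAs (IsIso (N.obj.map (𝟙 c))))
  let i : M.obj ≅ G.idVOp ⋙ G.squares f.hom :=
    (NatIso.ofComponents (fun c => @asIso _ _ _ _ _ (hiso c))
      (fun t => (G.squaresFst f.hom).naturality (G.idVOp.map t))).symm
  let v := H.obj.descOfIsLeftKanExtension α N.obj (G.squaresSnd f.hom)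
  have hv : α ≫ Functor.whiskerLeft _ v = G.squaresSnd f.hom :=
    H.obj.descOfIsLeftKanExtension_fac α N.obj (G.squaresSnd f.hom)
  let n : M.obj ⟶ H.obj := i.hom ≫ Functor.whiskerLeft G.idVOp α
  refine ⟨H, ObjectProperty.homMk n, ObjectProperty.homMk v, ⟨i, α, hα, fun c => rfl⟩,
    hloc M.obj N.obj f.hom _ _ hc v hv, ?_⟩
  ext c
  have h₁ := (hc (G.idVOp.obj c)).w
  have h₂ := congr_app hv (G.idVOp.obj c)
  change (i.hom.app c ≫ α.app (G.idVOp.obj c)) ≫ v.app c = f.hom.app c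
  refine (Category.assoc _ _ _).trans ((congrArg (i.hom.app c ≫ ·) h₂).trans ?_)
  refine (cancel_epi (i.inv.app c)).1 ((Iso.inv_hom_id_app_assoc i _ _).trans ?_)
  refine Eq.trans ?_ h₁.symm
  exact ((congrArg ((G.squaresSnd f.hom).app (G.idVOp.obj c) ≫ ·) (N.obj.map_id c)).trans
    (Category.comp_id _)).symm

/-- Lifting `l` against its own local part `v` gives a section `d` of `v`. Both `v ≫ d` and the
identity solve the lifting problem of the etale part against `v`, so `v` is invertible. -/
lemma et_of_exists_lift {X Y : C ⥤ₗ E} (l : X ⟶ Y)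
    (h : ∀ {Z : C ⥤ₗ E} (r : Z ⟶ Y) (a : X ⟶ Z), G.Loc E r → a ≫ r = l →
      ∃ d : Y ⟶ Z, l ≫ d = a ∧ d ≫ r = 𝟙 Y) : G.Et E l := by
  obtain ⟨H, n, v, hn, hv, rfl⟩ := G.exists_factorization l
  obtain ⟨d, h₁, h₂⟩ := h v n hv rfl
  have h₃ : v ≫ d = 𝟙 H :=
    (G.existsUnique_lift_of_classifies hn hv n v rfl).unique
      ⟨by rw [← Category.assoc, h₁], by rw [Category.assoc, h₂, Category.comp_id]⟩
      ⟨Category.comp_id _, Category.id_comp _⟩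
  have : IsIso v := ⟨d, h₃, h₂⟩
  exact ⟨_, hn.comp_isIso v⟩

variable (E)

theorem isFactorizationSystem : IsFactorizationSystem (G.Et E) (G.Loc E) where
  left_iso X Y f _ := G.et_of_exists_lift f fun r a _ h =>
    ⟨inv f ≫ a, by simp, by simp [h]⟩
  right_iso X Y f _ := G.loc_of_isIso f
  left_comp X Y Z f g := by
    rintro ⟨P, hf⟩ ⟨Q, hg⟩
    refine G.et_of_exists_lift _ fun r a hr h => ?_
    obtain ⟨d, ⟨h₁, h₂⟩, -⟩ := G.existsUnique_lift_of_classifies hf hr a g h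
    obtain ⟨d', ⟨rfl, h₄⟩, -⟩ :=
      G.existsUnique_lift_of_classifies hg hr d (𝟙 _) (h₂.trans (Category.comp_id _).symm)
    exact ⟨d', by rw [Category.assoc, h₁], h₄⟩
  right_comp X Y Z := G.loc_comp
  factorization X Y f := by
    obtain ⟨H, n, v, hn, hv, h⟩ := G.exists_factorization f
    exact ⟨H, n, v, ⟨_, hn⟩, hv, h⟩
  orthogonal X Y Z W l r a b := by
    rintro ⟨P, hl⟩ hr h
    exact G.existsUnique_lift_of_classifies hl hr a b h

end Geometry

/-! ### Inverse and direct images of local and etale arrows. -/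

/-- The adjunction on categories of arrows induced by an adjunction. -/
def CategoryTheory.Adjunction.mapArrow {A B : Type*} [Category* A] [Category* B] {L : A ⥤ B}
    {R : B ⥤ A} (adj : L ⊣ R) : L.mapArrow ⊣ R.mapArrow :=
  { unit := (Functor.mapArrowFunctor A A).map adj.unit
    counit := (Functor.mapArrowFunctor B B).map adj.counit
    left_triangle_components f := Arrow.hom_ext _ _ (adj.left_triangle_components f.left)
      (adj.left_triangle_components f.right)
    right_triangle_components f := Arrow.hom_ext _ _ (adj.right_triangle_components f.left)
      (adj.right_triangle_components f.right) }

section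

variable (C : Type u) [SmallCategory C] {F E : Type (u + 1)} [Category.{u} F] [Category.{u} E]
  (g : GeometricMorphism F E)

/-- The inverse image of models is left adjoint to the direct image. -/
noncomputable def GeometricMorphism.modelAdj : g.inverseImage C ⊣ g.directImage C :=
  (g.adj.whiskerRight C).restrictFullyFaithful (leftExactFunctor C E).fullyFaithfulι
    (leftExactFunctor C F).fullyFaithfulι (Iso.refl _) (Iso.refl _)

end

namespace Geometry

variable {C : Type u} [SmallCategory C] [HasFiniteLimits C] (G : Geometry C)

section Coreflection

variable {E : Type (u + 1)} [Category.{u} E] [IsGrothendieckTopos E]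

/-- The middle object of the factorization of an arrow of models. -/
noncomputable def etaleModel {M N : C ⥤ₗ E} (f : M ⟶ N) : C ⥤ₗ E :=
  (G.exists_factorization f).choose

/-- The etale part of an arrow of models. -/
noncomputable def etalePart {M N : C ⥤ₗ E} (f : M ⟶ N) : M ⟶ G.etaleModel f :=
  (G.exists_factorization f).choose_spec.choose

/-- The local part of an arrow of models. -/
noncomputable def localPart {M N : C ⥤ₗ E} (f : M ⟶ N) : G.etaleModel f ⟶ N :=
  (G.exists_factorization f).choose_spec.choose_spec.choose

lemma classifies_etalePart {M N : C ⥤ₗ E} (f : M ⟶ N) :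
    G.Classifies (G.squaresModel f) (G.etalePart f) :=
  (G.exists_factorization f).choose_spec.choose_spec.choose_spec.1

lemma loc_localPart {M N : C ⥤ₗ E} (f : M ⟶ N) : G.Loc E (G.localPart f) :=
  (G.exists_factorization f).choose_spec.choose_spec.choose_spec.2.1

lemma etalePart_localPart {M N : C ⥤ₗ E} (f : M ⟶ N) : G.etalePart f ≫ G.localPart f = f :=
  (G.exists_factorization f).choose_spec.choose_spec.choose_spec.2.2

/-- The etale part of an arrow of models, as an object of `Et[E]`. -/
noncomputable def etaleArrow (Y : Arrow (C ⥤ₗ E)) : G.EtCat E :=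
  ⟨Arrow.mk (G.etalePart Y.hom), _, G.classifies_etalePart Y.hom⟩

/-- The universal morphism from an etale arrow to an arrow of models. -/
noncomputable def etaleArrowHom (Y : Arrow (C ⥤ₗ E)) : (G.etaleArrow Y).obj ⟶ Y :=
  Arrow.homMk (𝟙 _) (G.localPart Y.hom)
    ((Category.id_comp _).trans (G.etalePart_localPart Y.hom).symm)

/-- The left component is unchanged, and orthogonality of `X` to the local part of `Y` determines
the right one. -/
lemma bijective_comp_etaleArrowHom (X : G.EtCat E) (Y : Arrow (C ⥤ₗ E)) :
    Function.Bijective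
      (fun h : X ⟶ G.etaleArrow Y => (h.hom ≫ G.etaleArrowHom Y : X.obj ⟶ Y)) := by
  obtain ⟨P, hP⟩ := X.property
  have key (a : X.obj ⟶ Y) := G.existsUnique_lift_of_classifies hP (G.loc_localPart Y.hom)
    (a.left ≫ G.etalePart Y.hom) a.right (by
      rw [Category.assoc, etalePart_localPart]
      exact a.w)
  constructor
  · intro h h' e
    have e₁ := congrArg Arrow.Hom.left e
    have e₂ := congrArg Arrow.Hom.right e
    replace e₁ : h.hom.left = h'.hom.left :=
      (Category.comp_id _).symm.trans (e₁.trans (Category.comp_id _))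
    apply ObjectProperty.hom_ext
    refine Arrow.hom_ext _ _ e₁ ((key (h.hom ≫ G.etaleArrowHom Y)).unique ⟨?_, rfl⟩ ⟨?_, e₂.symm⟩)
    · refine h.hom.w.symm.trans ?_
      exact congrArg (· ≫ G.etalePart Y.hom) (Category.comp_id _).symm
    · refine h'.hom.w.symm.trans ?_
      rw [← e₁]
      exact congrArg (· ≫ G.etalePart Y.hom) (Category.comp_id _).symm
  · intro a
    obtain ⟨d, ⟨h₁, h₂⟩, -⟩ := key a
    exact ⟨ObjectProperty.homMk (Arrow.homMk a.left d h₁.symm),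
      Arrow.hom_ext _ _ (Category.comp_id _) h₂⟩

/-- The universal property of the etale part of an arrow of models. -/
noncomputable def etaleArrowEquiv (X : G.EtCat E) (Y : Arrow (C ⥤ₗ E)) :
    ((G.etIncl E).obj X ⟶ Y) ≃ (X ⟶ G.etaleArrow Y) :=
  (Equiv.ofBijective _ (G.bijective_comp_etaleArrowHom X Y)).symm

lemma etaleArrowEquiv_naturality (X' X : G.EtCat E) (Y : Arrow (C ⥤ₗ E)) (f : X' ⟶ X)
    (h : (G.etIncl E).obj X ⟶ Y) :
    G.etaleArrowEquiv X' Y ((G.etIncl E).map f ≫ h) = f ≫ G.etaleArrowEquiv X Y h := by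
  refine (Equiv.symm_apply_eq _).2 ?_
  have e : (G.etaleArrowEquiv X Y h).hom ≫ G.etaleArrowHom Y = h :=
    (Equiv.ofBijective _ (G.bijective_comp_etaleArrowHom X Y)).apply_symm_apply h
  change f.hom ≫ h = (f.hom ≫ (G.etaleArrowEquiv X Y h).hom) ≫ G.etaleArrowHom Y
  rw [Category.assoc, e]

variable (E)

/-- The coreflection of arrows of models into etale arrows. -/
noncomputable def etaleCoreflection : Arrow (C ⥤ₗ E) ⥤ G.EtCat E :=
  Adjunction.rightAdjointOfEquiv G.etaleArrowEquiv G.etaleArrowEquiv_naturality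

/-- The inclusion of etale arrows is left adjoint to the coreflection. -/
noncomputable def etaleAdj : G.etIncl E ⊣ G.etaleCoreflection E :=
  Adjunction.adjunctionOfEquivRight G.etaleArrowEquiv G.etaleArrowEquiv_naturality

end Coreflection

section GeometricMorphism

variable {F E : Type (u + 1)} [Category.{u} F] [Category.{u} E] (g : GeometricMorphism F E)

variable {G} in
lemma Loc.inverseImage {M N : C ⥤ₗ E} {v : M ⟶ N} (h : G.Loc E v) :
    G.Loc F ((g.inverseImage C).map v) := fun _ _ w hw => by
  have := g.lex
  exact (h w hw).map g.inverse

variable {G} in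
lemma Loc.directImage {M N : C ⥤ₗ F} {v : M ⟶ N} (h : G.Loc F v) :
    G.Loc E ((g.directImage C).map v) := fun _ _ w hw => by
  have := g.adj.rightAdjoint_preservesLimits
  exact (h w hw).map g.direct

variable {G} in
lemma Classifies.inverseImage [IsGrothendieckTopos E] {P : G.VOp ⥤ₗ E} {M N : C ⥤ₗ E} {f : M ⟶ N}
    (h : G.Classifies P f) :
    G.Classifies ((g.inverseImage G.VOp).obj P) ((g.inverseImage C).map f) := by
  obtain ⟨i, α, hα, hi⟩ := h
  have := g.adj.leftAdjoint_preservesColimits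
  refine ⟨Functor.isoWhiskerRight i g.inverse,
    Functor.whiskerRight α g.inverse ≫ (Functor.associator _ _ _).hom,
    Functor.PreservesLeftKanExtension.preserves (G := g.inverse) N.obj α, fun c => ?_⟩
  refine (congrArg g.inverse.map (hi c)).trans ((g.inverse.map_comp _ _).trans ?_)
  exact congrArg (g.inverse.map (i.hom.app c) ≫ ·) (Category.comp_id _).symm

variable {G} in
lemma Et.inverseImage [IsGrothendieckTopos E] {M N : C ⥤ₗ E} {n : M ⟶ N} (h : G.Et E n) :
    G.Et F ((g.inverseImage C).map n) := by
  obtain ⟨P, hP⟩ := h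
  exact ⟨_, hP.inverseImage g⟩

/-- The inverse image functor on local arrows. -/
def locInverseImage : G.LocCat E ⥤ G.LocCat F :=
  ObjectProperty.lift _ (G.locIncl E ⋙ (g.inverseImage C).mapArrow)
    (fun v => Loc.inverseImage g v.property)

/-- The direct image functor on local arrows. -/
def locDirectImage : G.LocCat F ⥤ G.LocCat E :=
  ObjectProperty.lift _ (G.locIncl F ⋙ (g.directImage C).mapArrow)
    (fun v => Loc.directImage g v.property)

/-- The adjunction between inverse and direct image of local arrows. -/
noncomputable def locAdj : G.locInverseImage g ⊣ G.locDirectImage g :=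
  (g.modelAdj C).mapArrow.restrictFullyFaithful (ObjectProperty.fullyFaithfulι _)
    (ObjectProperty.fullyFaithfulι _) (Iso.refl _) (Iso.refl _)

variable [IsGrothendieckTopos E]

/-- The inverse image functor on etale arrows. -/
def etInverseImage : G.EtCat E ⥤ G.EtCat F :=
  ObjectProperty.lift _ (G.etIncl E ⋙ (g.inverseImage C).mapArrow)
    (fun n => Et.inverseImage g n.property)

/-- The right adjoint of the inverse image functor on etale arrows. -/
noncomputable def etDirectImage : G.EtCat F ⥤ G.EtCat E :=
  G.etIncl F ⋙ (g.directImage C).mapArrow ⋙ G.etaleCoreflection E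

/-- The adjunction for inverse images of etale arrows. -/
noncomputable def etAdj : G.etInverseImage g ⊣ G.etDirectImage g :=
  ((G.etaleAdj E).comp (g.modelAdj C).mapArrow).restrictFullyFaithful (Functor.FullyFaithful.id _)
    (ObjectProperty.fullyFaithfulι _) (Iso.refl _) (Iso.refl _)

/-- `Q` is the functor of squares of `n`, and `g_*` preserves this pullback; so `Q ⋙ g_*` is the
functor of squares of `g_* n`, which classifies the etale part of `g_* n`. -/
lemma classifies_etDirectImage [IsGrothendieckTopos F] (n : G.EtCat F) (Q : G.VOp ⥤ₗ F)
    (h : G.Classifies Q n.obj.hom) :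
    G.Classifies ((g.directImage G.VOp).obj Q) ((G.etDirectImage g).obj n).obj.hom := by
  have := g.adj.rightAdjoint_preservesLimits
  obtain ⟨β, α, hc⟩ := h.exists_isPullbackCone
  let f := (g.directImage C).map n.obj.hom
  have hc' : G.IsPullbackCone f.hom (P := Q.obj ⋙ g.direct)
      (Functor.whiskerRight β g.direct) (Functor.whiskerRight α g.direct) :=
    fun w => (hc w).map g.direct
  obtain ⟨e⟩ := (G.isPullbackCone_squares f.hom).nonempty_iso hc'
  exact (G.classifies_etalePart f).of_iso e

end GeometricMorphism

end Geometry

/-! ### Stability of epimorphic families, and continuity along local arrows. -/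

lemma epi_sigmaDesc_iff {E : Type*} [Category* E] {I : Type*} {A : I → E} [HasCoproduct A] {B : E}
    (s : ∀ i, A i ⟶ B) :
    Epi (Sigma.desc s) ↔ ∀ ⦃T : E⦄ (h h' : B ⟶ T), (∀ i, s i ≫ h = s i ≫ h') → h = h' := by
  constructor
  · intro _ T h h' e
    rw [← cancel_epi (Sigma.desc s)]
    ext i
    simp [e]
  · intro hs
    refine ⟨fun {T} h h' e => hs h h' fun i => ?_⟩
    simpa using Sigma.ι A i ≫= e

/-- In a Grothendieck topos, jointly epimorphic families are stable under pullback. -/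
lemma IsGrothendieckTopos.epi_sigmaDesc_of_isPullback {E : Type (u + 1)} [Category.{u} E]
    [IsGrothendieckTopos E] {I : Type u} {A A' : I → E} {B B' : E} {s : ∀ i, A i ⟶ B}
    {s' : ∀ i, A' i ⟶ B'} {t' : ∀ i, A' i ⟶ A i} {t : B' ⟶ B}
    (h : ∀ i, IsPullback (t' i) (s' i) (s i) t) (hs : Epi (Sigma.desc s)) :
    Epi (Sigma.desc s') := by
  obtain ⟨D, _, L, R, adj, _, _, _⟩ := IsGrothendieckTopos.exists_reflection E
  have : PreservesLimits R := adj.rightAdjoint_preservesLimits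
  rw [epi_sigmaDesc_iff] at hs ⊢
  -- The union of the presheaf images of the family. Its inclusion reflects to an isomorphism: a
  -- monomorphism by left exactness of `L`, an epimorphism by the hypothesis on the family.
  let S : Subfunctor (R.obj B) := ⨆ i, Subfunctor.range (R.map (s i))
  let p (i) : R.obj (A i) ⟶ S.toFunctor :=
    Subfunctor.lift (R.map (s i)) (le_iSup (fun i => Subfunctor.range (R.map (s i))) i)
  have hp (i) : p i ≫ S.ι = R.map (s i) := Subfunctor.lift_ι _ _
  have h₁ : Epi (L.map S.ι ≫ adj.counit.app B) := ⟨fun {T} k k' e => hs _ _ fun i => by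
    rw [← cancel_epi (adj.counit.app (A i))]
    refine (adj.counit_naturality_assoc (s i) k).symm.trans (Eq.trans ?_
      (adj.counit_naturality_assoc (s i) k'))
    rw [← hp, L.map_comp]
    simpa using L.map (p i) ≫= e⟩
  have h₂ : IsIso (L.map S.ι) := by
    have : IsIso (L.map S.ι ≫ adj.counit.app B) := isIso_of_mono_of_epi _
    exact IsIso.of_isIso_comp_right _ (adj.counit.app B)
  have hpb := IsPullback.of_hasPullback (R.map t) S.ι
  have h₃ : IsIso (L.map (pullback.fst (R.map t) S.ι)) := (hpb.map L).isIso_fst_of_isIso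
  intro T k k' e
  -- It suffices to compare `k` and `k'` on the subpresheaf pulled back from `S`; each of its
  -- elements comes from some `R.obj (A' i)`, because `R` preserves the given pullbacks.
  rw [← cancel_epi (adj.counit.app B'), ← cancel_epi (L.map (pullback.fst (R.map t) S.ι))]
  apply (adj.homEquiv _ _).injective
  rw [adj.homEquiv_naturality_left, adj.homEquiv_naturality_left,
    adj.homEquiv_naturality_right, adj.homEquiv_naturality_right]
  have h₄ : adj.homEquiv _ _ (adj.counit.app B') = 𝟙 (R.obj B') := by
    simp [Adjunction.homEquiv_unit]
  rw [h₄, Category.id_comp, Category.id_comp]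
  ext d y
  have hw : (R.map t).app d ((pullback.fst (R.map t) S.ι).app d y) =
      S.ι.app d ((pullback.snd (R.map t) S.ι).app d y) :=
    ConcreteCategory.congr_hom (congr_app hpb.w d) y
  obtain ⟨i, a, ha⟩ := Set.mem_iUnion.1
    ((Subfunctor.iSup_obj _ d).le ((pullback.snd (R.map t) S.ι).app d y).2)
  obtain ⟨a', -, ha'⟩ := Types.exists_of_isPullback (((h i).map R).app d) a
    ((pullback.fst (R.map t) S.ι).app d y)
    (Eq.trans ha hw.symm)
  change (R.map k).app d ((pullback.fst (R.map t) S.ι).app d y) =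
    (R.map k').app d ((pullback.fst (R.map t) S.ι).app d y)
  rw [← ha']
  have := congrArg R.map (e i)
  rw [R.map_comp, R.map_comp] at this
  exact ConcreteCategory.congr_hom (congr_app this d) a'

namespace Geometry

variable {C : Type u} [SmallCategory C] [HasFiniteLimits C] (G : Geometry C)

lemma isExtensionModel_of_loc {E : Type (u + 1)} [Category.{u} E] [IsGrothendieckTopos E]
    {M N : C ⥤ₗ E} (v : M ⟶ N) (hv : G.Loc E v) (hN : IsExtensionModel G.J N) :
    IsExtensionModel G.J M := by
  intro X I Y s hs
  -- The members of the sieve dual to maps in `V` still cover, and there the naturality squares of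
  -- `v` are pullbacks. Each factors through some `s i`, so equality on the original family implies
  -- equality on these.
  let T : Presieve X := fun Y f => Sieve.ofArrows _ s f ∧ G.V ((presentedModel C).map f.op)
  let K := Σ Y : C, {f : Y ⟶ X // T f}
  have hT : Sieve.ofArrows (fun k : K => k.1) (fun k => k.2.1) ∈ G.J X := by
    refine G.J.superset_covering ?_ (G.covers_generated _ hs)
    rw [Sieve.generate_le_iff]
    intro Y f hf
    exact Sieve.ofArrows_mk (fun k : K => k.1) (fun k => k.2.1) (⟨Y, f, hf⟩ : K)
  have h := IsGrothendieckTopos.epi_sigmaDesc_of_isPullback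
    (s := fun k : K => N.obj.map k.2.1) (s' := fun k : K => M.obj.map k.2.1) (t := v.hom.app X)
    (t' := fun k : K => v.hom.app k.1) (fun k => hv k.2.1 k.2.2.2) (hN X K _ _ hT)
  rw [epi_sigmaDesc_iff] at h ⊢
  intro Z a b e
  refine h a b ?_
  rintro ⟨Y', f, ⟨⟨W, q, _, ⟨i⟩, rfl⟩, -⟩⟩
  simp [e]

end Geometry

theorem mainTheorem8 {C : Type u} [SmallCategory C] [HasFiniteLimits C] (G : Geometry C) :
    -- `(Et[E], Loc[E])` is a factorization system on `T[E]`
    (∀ (E : Type (u + 1)) [Category.{u} E] [IsGrothendieckTopos E],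
      IsFactorizationSystem (G.Et E) (G.Loc E)) ∧
    -- for a geometric morphism `g : F ⟶ E`: stability under `g^*`, and the adjunctions between
    -- `Et[E]` and `Et[F]`, and between `Loc[E]` and `Loc[F]`
    (∀ (F E : Type (u + 1)) [Category.{u} F] [Category.{u} E]
      [IsGrothendieckTopos F] [IsGrothendieckTopos E] (g : GeometricMorphism F E),
      (∀ (M N : C ⥤ₗ E) (n : M ⟶ N), G.Et E n → G.Et F ((g.inverseImage C).map n)) ∧
      (∀ (M N : C ⥤ₗ E) (v : M ⟶ N), G.Loc E v → G.Loc F ((g.inverseImage C).map v)) ∧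
      (∃ (P : G.EtCat E ⥤ G.EtCat F) (R : G.EtCat F ⥤ G.EtCat E),
        Nonempty (P ⋙ G.etIncl F ≅ G.etIncl E ⋙ (g.inverseImage C).mapArrow) ∧
        (∀ (n : G.EtCat F) (Q : G.VOp ⥤ₗ F), G.Classifies Q n.obj.hom →
          G.Classifies ((g.directImage G.VOp).obj Q) (R.obj n).obj.hom) ∧
        Nonempty (P ⊣ R)) ∧
      (∃ (P : G.LocCat E ⥤ G.LocCat F) (R : G.LocCat F ⥤ G.LocCat E),
        Nonempty (P ⋙ G.locIncl F ≅ G.locIncl E ⋙ (g.inverseImage C).mapArrow) ∧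
        Nonempty (R ⋙ G.locIncl E ≅ G.locIncl F ⋙ (g.directImage C).mapArrow) ∧
        Nonempty (P ⊣ R))) ∧
    -- models of `T_J` are closed backwards along local arrows
    (∀ (E : Type (u + 1)) [Category.{u} E] [IsGrothendieckTopos E] (M N : C ⥤ₗ E) (v : M ⟶ N),
      G.Loc E v → IsExtensionModel G.J N → IsExtensionModel G.J M) ∧
    -- the middle object of the factorization of an arrow towards a model of `T_J` is a model
    -- of `T_J`
    (∀ (E : Type (u + 1)) [Category.{u} E] [IsGrothendieckTopos E] (M N : C ⥤ₗ E) (f : M ⟶ N),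
      IsExtensionModel G.J N →
      ∀ (H : C ⥤ₗ E) (n : M ⟶ H) (v : H ⟶ N), G.Et E n → G.Loc E v → n ≫ v = f →
        IsExtensionModel G.J H) ∧
    -- the geometry induces an admissibility structure
    IsAdmissibilityStructure G.J (fun E _ _ => G.Loc E) := by
  refine ⟨fun E _ _ => G.isFactorizationSystem E, fun F E _ _ _ _ g =>
    ⟨fun M N n h => h.inverseImage g, fun M N v h => h.inverseImage g,
      ⟨G.etInverseImage g, G.etDirectImage g, ⟨Iso.refl _⟩, G.classifies_etDirectImage g,
        ⟨G.etAdj g⟩⟩,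
      ⟨G.locInverseImage g, G.locDirectImage g, ⟨Iso.refl _⟩, ⟨Iso.refl _⟩, ⟨G.locAdj g⟩⟩⟩,
    fun E _ _ M N v => G.isExtensionModel_of_loc v,
    fun E _ _ M N f hN H n v _ hv _ => G.isExtensionModel_of_loc v hv hN,
    ⟨fun F E _ _ _ _ g M N v h => h.inverseImage g, fun E _ _ M N v _ => G.loc_of_isIso v,
      fun E _ _ M N P f v => G.loc_of_comp f v, fun E _ _ M N f hN => ?_⟩⟩
  -- Initiality is the orthogonality of `n` to the local arrow `w`.
  obtain ⟨H, n, v, hn, hv, h⟩ := G.exists_factorization f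
  exact ⟨H, n, v, hv, G.isExtensionModel_of_loc v hv hN, h, fun K a w hw e =>
    G.existsUnique_lift_of_classifies hn hw a v (e.trans h.symm)⟩
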